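/- Let $0<b\le a$, let $\mathsf A=\{(x_1,x_2)\in\mathbb R^2 : x_1^2/a^2+x_2^2/b^2<1\}$ be the open elliptic disk with semi-axes $a,b$, let $\varepsilon=\sqrt{1-b^2/a^2}$ be its eccentricity, and put $$K(e)=\int_0^{\pi/2}\frac{d\varphi}{\sqrt{1-e^2\sin^2\varphi}},\qquad D(e)=\int_0^{\pi/2}\frac{\sin^2\varphi}{\sqrt{1-e^2\sin^2\varphi}}\,d\varphi ,$$ so that $K(0)=\pi/2$ and $D(0)=\pi/4$. Define on $\mathsf A$ the source densities $$\rho_w(x_1,x_2)=\frac{1}{b\,K(\varepsilon)}\,\frac{1}{\sqrt{1-x_1^2/a^2-x_2^2/b^2}},\qquad \rho_t(x_1,x_2)=\frac{1}{b\,D(\varepsilon)}\,\frac{x_1}{\sqrt{1-x_1^2/a^2-x_2^2/b^2}},$$ and let $w,t:\mathbb R^3\to\mathbb R$ be the potentials they generate, $$w(x)=\frac1{2\pi}\int_{\mathsf A}\frac{\rho_w(y)}{|x-(y,0)|}\,dy,\qquad t(x)=\frac1{2\pi}\int_{\mathsf A}\frac{\rho_t(y)}{|x-(y,0)|}\,dy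 .$$ Then: 1. For every $x=(x_1,x_2)\in\mathsf A$ the integrals $\frac1{2\pi}\int_{\mathsf A}\frac{\rho_w(y)}{|x-y|}\,dy$ and $\frac1{2\pi}\int_{\mathsf A}\frac{\rho_t(y)}{|x-y|}\,dy$ converge absolutely and are equal to $1$ and to $x_1$, respectively. 2. Both $f=w$ and $f=t$ are harmonic in $\{x_3\ne0\}$, satisfy $\partial_{x_3}f(x',0)=0$ for $x'\notin\overline{\mathsf A}$, are continuous at the points of $\mathsf A\times\{0\}$, and there $w(x',0)=1$ and $t(x',0)=x_1$. 3. In each of the half-spaces $\{x_3>0\}$ and $\{x_3<0\}$ the Dirichlet energies are finite, and $$\int_{\pm x_3>0}|\nabla w|^2\,dx=4a\,\frac{K(0)}{K(\varepsilon)}\ \Bigl(=\frac{2\pi a}{K(\varepsilon)}\Bigr),\qquad \int_{\pm x_3>0}|\nabla t|^2\,dx=\frac83\,a^3\,\frac{D(0)}{D(\varepsilon)} .$$ -/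

import Mathlib

open scoped Gradient

noncomputable section

namespace EllipticAperture

/-- The elliptic disk with semi-axes `a` and `b`, as an open subset of the Euclidean plane. -/
def ellipticDisk (a b : ℝ) : Set (EuclideanSpace ℝ (Fin 2)) :=
  {y | y 0 ^ 2 / a ^ 2 + y 1 ^ 2 / b ^ 2 < 1}

/-- The eccentricity of the ellipse with semi-axes `a ≥ b`. -/
def eccentricity (a b : ℝ) : ℝ := Real.sqrt (1 - b ^ 2 / a ^ 2)

/-- The complete elliptic integral of the first kind, as a function of the eccentricity. -/
def ellipticK (ε : ℝ) : ℝ :=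
  ∫ φ in (0 : ℝ)..(Real.pi / 2), 1 / Real.sqrt (1 - ε ^ 2 * Real.sin φ ^ 2)

/-- The complete elliptic integral `D`, as a function of the eccentricity. -/
def ellipticD (ε : ℝ) : ℝ :=
  ∫ φ in (0 : ℝ)..(Real.pi / 2), Real.sin φ ^ 2 / Real.sqrt (1 - ε ^ 2 * Real.sin φ ^ 2)

/-- The point of Euclidean 3-space above the point `y` of the plane, at height `s`. -/
def lift3 (y : EuclideanSpace ℝ (Fin 2)) (s : ℝ) : EuclideanSpace ℝ (Fin 3) :=
  !₂[y 0, y 1, s]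

/-- The potential at `x` in 3-space generated by the source density `ρ` on the subset `A` of the
plane `x₃ = 0`, normalised by `1 / (2 π)`. -/
def singleLayer (A : Set (EuclideanSpace ℝ (Fin 2))) (ρ : EuclideanSpace ℝ (Fin 2) → ℝ)
    (x : EuclideanSpace ℝ (Fin 3)) : ℝ :=
  1 / (2 * Real.pi) * ∫ y in A, ρ y / ‖x - lift3 y 0‖

/-- The source density of the potential that is constant on the elliptic disk. -/
def rhoW (a b : ℝ) (y : EuclideanSpace ℝ (Fin 2)) : ℝ :=
  1 / (b * ellipticK (eccentricity a b) * Real.sqrt (1 - y 0 ^ 2 / a ^ 2 - y 1 ^ 2 / b ^ 2))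

/-- The source density of the potential that is equal to `x₁` on the elliptic disk. -/
def rhoT (a b : ℝ) (y : EuclideanSpace ℝ (Fin 2)) : ℝ :=
  y 0 / (b * ellipticD (eccentricity a b) * Real.sqrt (1 - y 0 ^ 2 / a ^ 2 - y 1 ^ 2 / b ^ 2))

/-- The potential generated by `rhoW` on the elliptic disk. -/
def potW (a b : ℝ) : EuclideanSpace ℝ (Fin 3) → ℝ :=
  singleLayer (ellipticDisk a b) (rhoW a b)

/-- The potential generated by `rhoT` on the elliptic disk. -/
def potT (a b : ℝ) : EuclideanSpace ℝ (Fin 3) → ℝ :=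
  singleLayer (ellipticDisk a b) (rhoT a b)

/-- The upper open half-space `x₃ > 0`. -/
def upperHalfSpace : Set (EuclideanSpace ℝ (Fin 3)) := {x | 0 < x 2}

/-- The lower open half-space `x₃ < 0`. -/
def lowerHalfSpace : Set (EuclideanSpace ℝ (Fin 3)) := {x | x 2 < 0}

/-- `f` has finite Dirichlet energy on `U`, and this energy is equal to `I`. -/
def HasDirichletEnergy (f : EuclideanSpace ℝ (Fin 3) → ℝ) (U : Set (EuclideanSpace ℝ (Fin 3)))
    (I : ℝ) : Prop :=
  MeasureTheory.IntegrableOn (fun x => ‖∇ f x‖ ^ 2) U ∧ ∫ x in U, ‖∇ f x‖ ^ 2 = I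

/-- `f` solves the mixed boundary value problem of an aperture `A` in the plane `x₃ = 0`, with
Dirichlet data `g` on `A`: it is harmonic off the plane, its normal derivative vanishes on the
plane outside the closed aperture, and on `A` it is equal to `g`, also as a limit from space. -/
structure SolvesApertureProblem (A : Set (EuclideanSpace ℝ (Fin 2)))
    (g : EuclideanSpace ℝ (Fin 2) → ℝ) (f : EuclideanSpace ℝ (Fin 3) → ℝ) : Prop where
  harmonic : InnerProductSpace.HarmonicOnNhd f {x | x 2 ≠ 0}
  neumann : ∀ y ∉ closure A, HasDerivAt (fun s : ℝ => f (lift3 y s)) 0 0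
  continuousAt : ∀ y ∈ A, ContinuousAt f (lift3 y 0)
  dirichlet : ∀ y ∈ A, f (lift3 y 0) = g y

end EllipticAperture

end

namespace EllipticAperture

open MeasureTheory Set Filter Topology

/-! ### Integrals along a chord and over the slopes of chords -/

section LineIntegrals

/-! Values on the aperture. Fix `x` in the ellipse and write `y = x + h (u, 1)`. The Jacobian `|h|`
cancels the distance `|h| √(1 + u²)`, so the kernel becomes `1 / √(1 + u²)`. On the chord of slope
parameter `u` the density profile is `(M - q (h - m)²)^(-1/2)` with `q = u²/a² + 1/b²`, and its
integral over the chord is `π/√q`, free of `x` (`integral_inv_sqrt_sub_mul_sq`). The potential of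
the profile is therefore constant, and `u = tan φ` turns the constant into `K`. With the extra
factor `y₁` only the first coordinate of the midpoint of the chord survives; it is linear in `x`,
its `x₂` part is odd in `u`, and the rest is a form of `D` (`integral_cos_sq_div_delta_cube`).

Boundary value problem. Off the closed ellipse all derivatives pass under the integral, so
harmonicity comes from the Newton kernel, and evenness in `x₃` gives the Neumann condition.
Continuity on the aperture follows by cutting the density into a bounded part near the point and an
integrable part away from it.

Energy. No boundary terms are needed: `|∇f|²` is a double integral over pairs of sources, and the
interaction of two sources in a half-space is exactly `2π/|y - z|` (`integral_pairEnergy_zero`),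
found by integrating along rays issuing from one source. Fubini, justified by
`integrable_interaction`, makes the energy `(1/2π) ∬ ρ(y) ρ(z)/|y - z|`. As the potential on the
aperture is the known datum `g`, this is `∫ ρ g`, a moment of the profile of order 0 for `w` and 2
for `t`. -/

theorem integrable_inv_sqrt_one_sub_sq : Integrable fun s : ℝ => (√(1 - s ^ 2))⁻¹ := by
  have h : IntegrableOn (fun s : ℝ => (√(1 - s ^ 2))⁻¹) (Ioc (-1) 1) := by
    refine intervalIntegral.integrableOn_deriv_of_nonneg (g := Real.arcsin)
      Real.continuous_arcsin.continuousOn (fun x hx => ?_) (fun x _ => by positivity)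
    simpa using Real.hasDerivAt_arcsin hx.1.ne' hx.2.ne
  -- Since `√` of a negative number and `0⁻¹` are both `0`, the integrand vanishes off the interval.
  -- The same defaults later extend densities by zero off the ellipse.
  refine h.integrable_of_forall_notMem_eq_zero fun s hs => ?_
  have : 1 - s ^ 2 ≤ 0 := by
    simp only [mem_Ioc, not_and_or, not_lt, not_le] at hs
    rcases hs with hs | hs <;> nlinarith
  simp [Real.sqrt_eq_zero_of_nonpos this]

theorem integral_inv_sqrt_one_sub_sq : ∫ s : ℝ, (√(1 - s ^ 2))⁻¹ = Real.pi := by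
  have h0 : ∀ s ∉ Ioc (-1 : ℝ) 1, (√(1 - s ^ 2))⁻¹ = 0 := by
    intro s hs
    have : 1 - s ^ 2 ≤ 0 := by
      simp only [mem_Ioc, not_and_or, not_lt, not_le] at hs
      rcases hs with hs | hs <;> nlinarith
    simp [Real.sqrt_eq_zero_of_nonpos this]
  rw [← setIntegral_eq_integral_of_forall_compl_eq_zero h0,
    ← intervalIntegral.integral_of_le (by norm_num),
    intervalIntegral.integral_eq_sub_of_hasDerivAt_of_le (by norm_num)
      Real.continuous_arcsin.continuousOn (fun x hx => by
        simpa using Real.hasDerivAt_arcsin hx.1.ne' hx.2.ne)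
      integrable_inv_sqrt_one_sub_sq.intervalIntegrable]
  simp

theorem integrable_mul_inv_sqrt_one_sub_sq : Integrable fun s : ℝ => s * (√(1 - s ^ 2))⁻¹ := by
  refine integrable_inv_sqrt_one_sub_sq.mono (by fun_prop) (.of_forall fun s => ?_)
  rw [norm_mul]
  by_cases hs : |s| ≤ 1
  · exact mul_le_of_le_one_left (norm_nonneg _) hs
  · have : 1 - s ^ 2 ≤ 0 := by
      have := (one_lt_sq_iff_one_lt_abs s).2 (not_le.1 hs)
      linarith
    simp [Real.sqrt_eq_zero_of_nonpos this]

theorem inv_sqrt_sub_mul_sq {M q : ℝ} (hM : 0 < M) (hq : 0 < q) (m h : ℝ) :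
    (√(M - q * (h - m) ^ 2))⁻¹ =
      (√M)⁻¹ * (√(1 - (√(q / M) * (h - m)) ^ 2))⁻¹ := by
  rw [← mul_inv, ← Real.sqrt_mul hM.le, mul_pow, Real.sq_sqrt (by positivity)]
  congr 2
  field_simp

theorem integrable_inv_sqrt_sub_mul_sq {M q : ℝ} (hM : 0 < M) (hq : 0 < q) (m : ℝ) :
    Integrable fun h : ℝ => (√(M - q * (h - m) ^ 2))⁻¹ := by
  simp_rw [inv_sqrt_sub_mul_sq hM hq]
  have h1 : √(q / M) ≠ 0 := by positivity
  exact ((integrable_inv_sqrt_one_sub_sq.comp_mul_left' h1).comp_sub_right m).const_mul _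

/-- The affine change of variable gives a factor `√(M/q)` that cancels the `√M` of the integrand.
Independence of `M` and `m` is what makes the potential constant on the ellipse. -/
theorem integral_inv_sqrt_sub_mul_sq {M q : ℝ} (hM : 0 < M) (hq : 0 < q) (m : ℝ) :
    ∫ h : ℝ, (√(M - q * (h - m) ^ 2))⁻¹ = Real.pi / √q := by
  simp_rw [inv_sqrt_sub_mul_sq hM hq]
  rw [integral_const_mul,
    integral_sub_right_eq_self (fun h : ℝ => (√(1 - (√(q / M) * h) ^ 2))⁻¹) m,
    Measure.integral_comp_mul_left (fun h : ℝ => (√(1 - h ^ 2))⁻¹),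
    integral_inv_sqrt_one_sub_sq, Real.sqrt_div hq.le, abs_of_pos (by positivity)]
  have := Real.sqrt_pos.2 hM
  have := Real.sqrt_pos.2 hq
  simp only [smul_eq_mul]
  field_simp

theorem integrable_sub_mul_inv_sqrt_sub_mul_sq {M q : ℝ} (hM : 0 < M) (hq : 0 < q) (m : ℝ) :
    Integrable fun h : ℝ => (h - m) * (√(M - q * (h - m) ^ 2))⁻¹ := by
  have h1 : √(q / M) ≠ 0 := by positivity
  have := (((integrable_mul_inv_sqrt_one_sub_sq.comp_mul_left' h1).comp_sub_right m).const_mul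
    ((√M)⁻¹ * (√(q / M))⁻¹))
  refine this.congr (.of_forall fun h => ?_)
  simp only [inv_sqrt_sub_mul_sq hM hq]
  field_simp

theorem integral_sub_mul_inv_sqrt_sub_mul_sq (M q m : ℝ) :
    ∫ h : ℝ, (h - m) * (√(M - q * (h - m) ^ 2))⁻¹ = 0 := by
  rw [integral_sub_right_eq_self (fun h : ℝ => h * (√(M - q * h ^ 2))⁻¹) m]
  have := integral_neg_eq_self (fun h : ℝ => h * (√(M - q * h ^ 2))⁻¹) volume
  simp only [neg_mul, neg_sq, integral_neg] at this
  linarith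

theorem integral_eq_setIntegral_tan (g : ℝ → ℝ) :
    ∫ u, g u = ∫ φ in Ioo (-(Real.pi / 2)) (Real.pi / 2), (Real.cos φ ^ 2)⁻¹ * g (Real.tan φ) := by
  rw [← setIntegral_univ, ← Real.image_tan_Ioo,
    integral_image_eq_integral_abs_deriv_smul (f' := fun φ => (Real.cos φ ^ 2)⁻¹)
      measurableSet_Ioo (fun φ hφ => ?_) Real.injOn_tan]
  · simp
  · simpa using (Real.hasDerivAt_tan (Real.cos_pos_of_mem_Ioo hφ).ne').hasDerivWithinAt

theorem setIntegral_Ioo_eq_two_mul {g : ℝ → ℝ} (hg : Continuous g) (heven : ∀ φ, g (-φ) = g φ) :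
    ∫ φ in Ioo (-(Real.pi / 2)) (Real.pi / 2), g φ = 2 * ∫ φ in (0 : ℝ)..(Real.pi / 2), g φ := by
  rw [← integral_Ioc_eq_integral_Ioo, ← intervalIntegral.integral_of_le (by linarith [Real.pi_pos]),
    ← intervalIntegral.integral_add_adjacent_intervals (b := 0) (hg.intervalIntegrable _ _)
      (hg.intervalIntegrable _ _)]
  have := intervalIntegral.integral_comp_neg (a := 0) (b := Real.pi / 2) g
  simp only [heven, neg_zero] at this
  rw [← this]; ring

variable {a b : ℝ}

theorem eccentricity_sq (hb : 0 < b) (hab : b ≤ a) : eccentricity a b ^ 2 = 1 - b ^ 2 / a ^ 2 := by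
  have ha : 0 < a := hb.trans_le hab
  have h1 : b ^ 2 / a ^ 2 ≤ 1 := by
    rw [div_le_one (by positivity)]; gcongr
  rw [eccentricity, Real.sq_sqrt (by linarith)]

theorem one_sub_eccentricity_sq (hb : 0 < b) (hab : b ≤ a) (s : ℝ) (hs : s ^ 2 ≤ 1) :
    0 < 1 - eccentricity a b ^ 2 * s ^ 2 := by
  have ha : 0 < a := hb.trans_le hab
  have h1 : b ^ 2 / a ^ 2 ≤ 1 := by
    rw [div_le_one (by positivity)]; gcongr
  have h2 : 0 < b ^ 2 / a ^ 2 := by positivity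
  rw [eccentricity_sq hb hab]
  nlinarith [mul_nonneg (sub_nonneg.2 h1) (sub_nonneg.2 hs)]

theorem delta_pos (hb : 0 < b) (hab : b ≤ a) (φ : ℝ) :
    0 < 1 - eccentricity a b ^ 2 * Real.sin φ ^ 2 :=
  one_sub_eccentricity_sq hb hab _ (Real.sin_sq_le_one φ)

theorem continuous_inv_delta (hb : 0 < b) (hab : b ≤ a) :
    Continuous fun φ => (√(1 - eccentricity a b ^ 2 * Real.sin φ ^ 2))⁻¹ :=
  Continuous.inv₀ (by fun_prop) fun φ => (Real.sqrt_pos.2 (delta_pos hb hab φ)).ne'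

theorem ellipticK_pos (hb : 0 < b) (hab : b ≤ a) : 0 < ellipticK (eccentricity a b) := by
  refine intervalIntegral.intervalIntegral_pos_of_pos_on ?_ (fun φ _ => ?_)
    (by linarith [Real.pi_pos])
  · simpa using (continuous_inv_delta hb hab).intervalIntegrable _ _
  · have := Real.sqrt_pos.2 (delta_pos hb hab φ)
    positivity

theorem ellipticD_pos (hb : 0 < b) (hab : b ≤ a) : 0 < ellipticD (eccentricity a b) := by
  refine intervalIntegral.intervalIntegral_pos_of_pos_on ?_ (fun φ hφ => ?_)
    (by linarith [Real.pi_pos])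
  · simp only [div_eq_mul_inv]
    exact ((Real.continuous_sin.pow 2).mul (continuous_inv_delta hb hab)).intervalIntegrable _ _
  · have := Real.sqrt_pos.2 (delta_pos hb hab φ)
    have := Real.sin_pos_of_pos_of_lt_pi hφ.1 (by linarith [hφ.2, Real.pi_pos])
    positivity

theorem sqrt_slope_tan (hb : 0 < b) (hab : b ≤ a) {φ : ℝ} (hφ : 0 < Real.cos φ) :
    √(Real.tan φ ^ 2 / a ^ 2 + 1 / b ^ 2) =
      √(1 - eccentricity a b ^ 2 * Real.sin φ ^ 2) / (b * Real.cos φ) := by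
  have ha : 0 < a := hb.trans_le hab
  rw [← Real.sqrt_sq (by positivity : 0 ≤ b * Real.cos φ), ← Real.sqrt_div (delta_pos hb hab φ).le,
    eccentricity_sq hb hab, Real.tan_eq_sin_div_cos]
  congr 1
  field_simp
  rw [Real.sin_sq]; ring

theorem integral_slope_eq_ellipticK (hb : 0 < b) (hab : b ≤ a) :
    ∫ u : ℝ, (√(1 + u ^ 2))⁻¹ * (√(u ^ 2 / a ^ 2 + 1 / b ^ 2))⁻¹ =
      2 * b * ellipticK (eccentricity a b) := by
  rw [integral_eq_setIntegral_tan]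
  have : ∀ φ ∈ Ioo (-(Real.pi / 2)) (Real.pi / 2), (Real.cos φ ^ 2)⁻¹ *
      ((√(1 + Real.tan φ ^ 2))⁻¹ * (√(Real.tan φ ^ 2 / a ^ 2 + 1 / b ^ 2))⁻¹) =
      b * (√(1 - eccentricity a b ^ 2 * Real.sin φ ^ 2))⁻¹ := by
    intro φ hφ
    have hc := Real.cos_pos_of_mem_Ioo hφ
    have := Real.sqrt_pos.2 (delta_pos hb hab φ)
    rw [Real.inv_sqrt_one_add_tan_sq hc, sqrt_slope_tan hb hab hc]
    field_simp
  rw [setIntegral_congr_fun measurableSet_Ioo this, integral_const_mul,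
    setIntegral_Ioo_eq_two_mul (continuous_inv_delta hb hab) (by simp), ellipticK]
  simp only [one_div]; ring

/-- With `Δ = √(1 - e² sin² φ)`, the difference of the two integrands is the derivative of `sin φ
cos φ / Δ`, which vanishes at both ends. -/
theorem integral_cos_sq_div_delta_cube (hb : 0 < b) (hab : b ≤ a) :
    ∫ φ in (0 : ℝ)..(Real.pi / 2),
      Real.cos φ ^ 2 * (√(1 - eccentricity a b ^ 2 * Real.sin φ ^ 2))⁻¹ ^ 3 =
      ellipticD (eccentricity a b) := by
  set e := eccentricity a b
  have hc := continuous_inv_delta hb hab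
  have h1 : IntervalIntegrable (fun φ => Real.cos φ ^ 2 *
      (√(1 - e ^ 2 * Real.sin φ ^ 2))⁻¹ ^ 3) volume 0 (Real.pi / 2) :=
    ((Real.continuous_cos.pow 2).mul (hc.pow 3)).intervalIntegrable _ _
  have h2 : IntervalIntegrable (fun φ => Real.sin φ ^ 2 *
      (√(1 - e ^ 2 * Real.sin φ ^ 2))⁻¹) volume 0 (Real.pi / 2) :=
    ((Real.continuous_sin.pow 2).mul hc).intervalIntegrable _ _
  rw [ellipticD, ← sub_eq_zero]
  simp only [div_eq_mul_inv]
  rw [← div_eq_mul_inv, ← intervalIntegral.integral_sub h1 h2,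
    intervalIntegral.integral_eq_sub_of_hasDerivAt (f := fun φ => Real.sin φ * Real.cos φ *
      (√(1 - e ^ 2 * Real.sin φ ^ 2))⁻¹) (fun φ _ => ?_) (h1.sub h2)]
  · simp
  · have hp := delta_pos hb hab φ
    have hs := Real.sqrt_pos.2 hp
    have hd : HasDerivAt (fun φ => 1 - e ^ 2 * Real.sin φ ^ 2)
        (-(e ^ 2 * (2 * Real.sin φ * Real.cos φ))) φ := by
      have := (((Real.hasDerivAt_sin φ).pow 2).const_mul (e ^ 2)).const_sub 1
      simpa using this
    have := ((Real.hasDerivAt_sin φ).mul (Real.hasDerivAt_cos φ)).mul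
      ((hd.sqrt hp.ne').inv hs.ne')
    refine this.congr_deriv ?_
    rw [Pi.mul_apply, Pi.inv_apply]
    have hq : √(1 - e ^ 2 * Real.sin φ ^ 2) ^ 2 = 1 - e ^ 2 * Real.sin φ ^ 2 := Real.sq_sqrt hp.le
    generalize √(1 - e ^ 2 * Real.sin φ ^ 2) = r at hs hq ⊢
    have hcs := Real.cos_sq' φ
    field_simp
    rw [hq, hcs]; ring

theorem integral_slope_eq_ellipticD (hb : 0 < b) (hab : b ≤ a) :
    ∫ u : ℝ, (√(1 + u ^ 2))⁻¹ * (√(u ^ 2 / a ^ 2 + 1 / b ^ 2))⁻¹ ^ 3 =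
      2 * b ^ 3 * ellipticD (eccentricity a b) := by
  rw [integral_eq_setIntegral_tan]
  have : ∀ φ ∈ Ioo (-(Real.pi / 2)) (Real.pi / 2), (Real.cos φ ^ 2)⁻¹ *
      ((√(1 + Real.tan φ ^ 2))⁻¹ * (√(Real.tan φ ^ 2 / a ^ 2 + 1 / b ^ 2))⁻¹ ^ 3) =
      b ^ 3 * (Real.cos φ ^ 2 * (√(1 - eccentricity a b ^ 2 * Real.sin φ ^ 2))⁻¹ ^ 3) := by
    intro φ hφ
    have hc := Real.cos_pos_of_mem_Ioo hφ
    have := Real.sqrt_pos.2 (delta_pos hb hab φ)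
    rw [Real.inv_sqrt_one_add_tan_sq hc, sqrt_slope_tan hb hab hc]
    field_simp
  rw [setIntegral_congr_fun measurableSet_Ioo this, integral_const_mul,
    setIntegral_Ioo_eq_two_mul (g := fun φ => Real.cos φ ^ 2 *
      (√(1 - eccentricity a b ^ 2 * Real.sin φ ^ 2))⁻¹ ^ 3) ((Real.continuous_cos.pow 2).mul
      ((continuous_inv_delta hb hab).pow 3)) (by simp), integral_cos_sq_div_delta_cube hb hab]
  ring

/-- As `b ≤ a`, the form `u²/a² + 1/b²` is at least `(1 + u²)/a²`, so the integrand is at most `a /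
(1 + u²)`. -/
theorem integrable_slope (hb : 0 < b) (hab : b ≤ a) :
    Integrable fun u : ℝ => (√(1 + u ^ 2))⁻¹ * (√(u ^ 2 / a ^ 2 + 1 / b ^ 2))⁻¹ := by
  have ha : 0 < a := hb.trans_le hab
  refine (integrable_inv_one_add_sq.const_mul a).mono' (by fun_prop) (.of_forall fun u => ?_)
  rw [Real.norm_of_nonneg (by positivity), ← mul_inv, ← Real.sqrt_mul (by positivity)]
  have : (1 + u ^ 2) / a ≤ √((1 + u ^ 2) * (u ^ 2 / a ^ 2 + 1 / b ^ 2)) := by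
    refine Real.le_sqrt_of_sq_le ?_
    have : 1 / a ^ 2 ≤ 1 / b ^ 2 := by gcongr
    calc ((1 + u ^ 2) / a) ^ 2 = (1 + u ^ 2) * (u ^ 2 / a ^ 2 + 1 / a ^ 2) := by
          field_simp; ring
      _ ≤ _ := by gcongr
  calc _ ≤ ((1 + u ^ 2) / a)⁻¹ := by gcongr
    _ = _ := by field_simp

end LineIntegrals

/-! ### Conical coordinates -/

section Cone

variable {E F : Type*} [NormedAddCommGroup E] [NormedSpace ℝ E] [FiniteDimensional ℝ E]
  [MeasurableSpace E] [BorelSpace E] (μ : Measure E) [μ.IsAddHaarMeasure]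

/-- On each slice of height `h ≠ 0` the map is a dilation by `h`, which scales Haar measure by `|h|`
to the dimension; no Jacobian of the whole map is needed. -/
theorem lintegral_prod_eq_lintegral_cone {f : E × ℝ → ENNReal} (hf : Measurable f) :
    ∫⁻ p, f p ∂(μ.prod volume) =
      ∫⁻ p, ENNReal.ofReal (|p.2| ^ Module.finrank ℝ E) * f (p.2 • p.1, p.2)
        ∂(μ.prod volume) := by
  rw [lintegral_prod_symm _ hf.aemeasurable, lintegral_prod_symm _ (by fun_prop)]
  refine lintegral_congr_ae ?_
  filter_upwards [Measure.ae_ne volume (0 : ℝ)] with h hh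
  have hfh : Measurable fun u => f (u, h) := by fun_prop
  rw [lintegral_const_mul _ (by fun_prop),
    ← lintegral_map (f := fun u => f (u, h)) (μ := μ) hfh (measurable_const_smul h),
    Measure.map_addHaar_smul μ hh, lintegral_smul_measure, smul_eq_mul, ← mul_assoc,
    ← ENNReal.ofReal_mul (by positivity), abs_inv, abs_pow, mul_inv_cancel₀ (by positivity)]
  simp

theorem map_cone :
    Measure.map (fun p : E × ℝ => (p.2 • p.1, p.2))
      ((μ.prod volume).withDensity fun p => ENNReal.ofReal (|p.2| ^ Module.finrank ℝ E)) =
      μ.prod volume := by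
  refine Measure.ext_of_lintegral _ fun f hf => ?_
  rw [lintegral_map hf (by fun_prop), lintegral_withDensity_eq_lintegral_mul _ (by fun_prop)
    (by fun_prop), lintegral_prod_eq_lintegral_cone μ hf]
  rfl

theorem integrable_cone_iff {f : E × ℝ → ℝ} (hf : Measurable f) :
    Integrable f (μ.prod volume) ↔
      Integrable (fun p => |p.2| ^ Module.finrank ℝ E * f (p.2 • p.1, p.2)) (μ.prod volume) := by
  conv_lhs => rw [← map_cone μ]
  rw [integrable_map_measure hf.aestronglyMeasurable (by fun_prop),
    integrable_withDensity_iff_integrable_smul' (by fun_prop) (by simp)]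
  simp [ENNReal.toReal_ofReal]

theorem integral_cone {f : E × ℝ → ℝ} (hf : Measurable f) :
    ∫ p, f p ∂(μ.prod volume) =
      ∫ p, |p.2| ^ Module.finrank ℝ E * f (p.2 • p.1, p.2) ∂(μ.prod volume) := by
  conv_lhs => rw [← map_cone μ]
  rw [integral_map (by fun_prop) hf.aestronglyMeasurable,
    integral_withDensity_eq_integral_toReal_smul (by fun_prop) (by simp)]
  simp [ENNReal.toReal_ofReal]

end Cone

/-! ### Coordinates on the plane and on space -/

theorem continuous_lift3 : Continuous fun p : EuclideanSpace ℝ (Fin 2) × ℝ => lift3 p.1 p.2 := by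
  refine (PiLp.continuous_toLp 2 _).comp (continuous_pi fun i => ?_)
  fin_cases i <;> simp <;> fun_prop

theorem continuous_vec2 : Continuous fun p : ℝ × ℝ => !₂[p.1, p.2] := by
  refine (PiLp.continuous_toLp 2 _).comp (continuous_pi fun i => ?_)
  fin_cases i <;> simp <;> fun_prop

/-- Euclidean 3-space as a product of the plane with the vertical axis. -/
def spaceEquiv : EuclideanSpace ℝ (Fin 2) × ℝ ≃ᵐ EuclideanSpace ℝ (Fin 3) where
  toFun p := lift3 p.1 p.2
  invFun x := (!₂[x 0, x 1], x 2)
  left_inv p := by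
    ext i
    · fin_cases i <;> simp [lift3]
    · simp [lift3]
  right_inv x := by ext i; fin_cases i <;> simp [lift3]
  measurable_toFun := continuous_lift3.measurable
  measurable_invFun := by
    refine Measurable.prodMk ?_ (by simp; fun_prop)
    exact continuous_vec2.measurable.comp (f := fun x : EuclideanSpace ℝ (Fin 3) => (x 0, x 1))
      (by fun_prop)

/-- The Euclidean plane as a product of two lines. -/
def planeEquiv : ℝ × ℝ ≃ᵐ EuclideanSpace ℝ (Fin 2) where
  toFun p := !₂[p.1, p.2]
  invFun y := (y 0, y 1)
  left_inv p := by simp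
  right_inv x := by ext i; fin_cases i <;> simp
  measurable_toFun := continuous_vec2.measurable
  measurable_invFun := by simp; fun_prop

theorem measurePreserving_planeEquiv : MeasurePreserving planeEquiv := by
  have h := (volume_preserving_finTwoArrow ℝ).comp (PiLp.volume_preserving_ofLp (Fin 2))
  exact MeasurePreserving.symm planeEquiv.symm h

theorem measurePreserving_spaceEquiv : MeasurePreserving spaceEquiv := by
  have h1 := (volume_preserving_piFinSuccAbove (fun _ : Fin 3 => ℝ) (Fin.last 2)).comp
    (PiLp.volume_preserving_ofLp (Fin 3))
  have h2 := (PiLp.volume_preserving_toLp (Fin 2)).prod (MeasurePreserving.id (volume : Measure ℝ))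
  have h3 := (h2.comp Measure.measurePreserving_swap).comp h1
  refine MeasurePreserving.symm spaceEquiv.symm ?_
  convert h3 using 1
  ext x i
  · fin_cases i <;> rfl
  · rfl
  · exact Measure.volume_eq_prod _ _

/-- The pair `p` is (slope, signed height) of a point seen from `x`. The weight `|p.2|` is there to
absorb the singularity of `1/‖x - y‖`. -/
theorem integrable_plane_cone_iff (x : EuclideanSpace ℝ (Fin 2)) {f : EuclideanSpace ℝ (Fin 2) → ℝ}
    (hf : Measurable f) : Integrable f ↔
      Integrable fun p : ℝ × ℝ => |p.2| * f (x + !₂[p.2 * p.1, p.2]) := by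
  have hm : Measurable fun p : ℝ × ℝ => f (x + !₂[p.1, p.2]) :=
    hf.comp (measurable_const.add continuous_vec2.measurable)
  have h := integrable_cone_iff (volume : Measure ℝ) hm
  simp only [Module.finrank_self, pow_one, smul_eq_mul] at h
  rw [Measure.volume_eq_prod, ← h, ← (measurePreserving_add_left volume x).integrable_comp_emb
    (MeasurableEquiv.addLeft x).measurableEmbedding,
    ← measurePreserving_planeEquiv.integrable_comp_emb planeEquiv.measurableEmbedding]
  rfl

theorem integral_plane_cone (x : EuclideanSpace ℝ (Fin 2)) {f : EuclideanSpace ℝ (Fin 2) → ℝ}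
    (hf : Measurable f) :
    ∫ y, f y = ∫ p : ℝ × ℝ, |p.2| * f (x + !₂[p.2 * p.1, p.2]) := by
  have hm : Measurable fun p : ℝ × ℝ => f (x + !₂[p.1, p.2]) :=
    hf.comp (measurable_const.add continuous_vec2.measurable)
  have h := integral_cone (volume : Measure ℝ) hm
  simp only [Module.finrank_self, pow_one, smul_eq_mul] at h
  rw [Measure.volume_eq_prod, ← h, ← (measurePreserving_add_left volume x).integral_comp
    (MeasurableEquiv.addLeft x).measurableEmbedding,
    ← measurePreserving_planeEquiv.integral_comp planeEquiv.measurableEmbedding]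
  rfl

/-- The weight `p.2 ^ 2` compensates the inverse-square singularity of the gradient of the Newton
kernel at the apex `z`. -/
theorem integrable_space_cone_iff (z : EuclideanSpace ℝ (Fin 3)) {f : EuclideanSpace ℝ (Fin 3) → ℝ}
    (hf : Measurable f) : Integrable f ↔
      Integrable fun p : EuclideanSpace ℝ (Fin 2) × ℝ =>
        p.2 ^ 2 * f (z + lift3 (p.2 • p.1) p.2) := by
  have hm : Measurable fun p : EuclideanSpace ℝ (Fin 2) × ℝ => f (z + lift3 p.1 p.2) :=
    hf.comp (measurable_const.add continuous_lift3.measurable)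
  have h := integrable_cone_iff (volume : Measure (EuclideanSpace ℝ (Fin 2))) hm
  simp only [finrank_euclideanSpace_fin, sq_abs] at h
  rw [Measure.volume_eq_prod, ← h, ← (measurePreserving_add_left volume z).integrable_comp_emb
    (MeasurableEquiv.addLeft z).measurableEmbedding,
    ← measurePreserving_spaceEquiv.integrable_comp_emb spaceEquiv.measurableEmbedding]
  rfl

theorem integral_space_cone (z : EuclideanSpace ℝ (Fin 3)) {f : EuclideanSpace ℝ (Fin 3) → ℝ}
    (hf : Measurable f) :
    ∫ x, f x = ∫ p : EuclideanSpace ℝ (Fin 2) × ℝ, p.2 ^ 2 * f (z + lift3 (p.2 • p.1) p.2) := by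
  have hm : Measurable fun p : EuclideanSpace ℝ (Fin 2) × ℝ => f (z + lift3 p.1 p.2) :=
    hf.comp (measurable_const.add continuous_lift3.measurable)
  have h := integral_cone (volume : Measure (EuclideanSpace ℝ (Fin 2))) hm
  simp only [finrank_euclideanSpace_fin, sq_abs] at h
  rw [Measure.volume_eq_prod, ← h, ← (measurePreserving_add_left volume z).integral_comp
    (MeasurableEquiv.addLeft z).measurableEmbedding,
    ← measurePreserving_spaceEquiv.integral_comp spaceEquiv.measurableEmbedding]
  rfl

/-! ### Potentials on the ellipse, by integration over chords -/

section PlanePotential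

variable {a b : ℝ}

/-- The density profile `(1 - y₁² / a² - y₂² / b²)^(-1/2)`, equal to zero off the elliptic disk. -/
noncomputable def profile (a b : ℝ) (y : EuclideanSpace ℝ (Fin 2)) : ℝ :=
  (√(1 - y 0 ^ 2 / a ^ 2 - y 1 ^ 2 / b ^ 2))⁻¹

@[fun_prop]
theorem measurable_profile : Measurable (profile a b) := by
  unfold profile
  fun_prop

theorem profile_nonneg (y : EuclideanSpace ℝ (Fin 2)) : 0 ≤ profile a b y := by
  unfold profile
  positivity

theorem profile_eq_zero {y : EuclideanSpace ℝ (Fin 2)} (hy : y ∉ ellipticDisk a b) :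
    profile a b y = 0 := by
  have : 1 - y 0 ^ 2 / a ^ 2 - y 1 ^ 2 / b ^ 2 ≤ 0 := by
    simp only [ellipticDisk, mem_ofPred_eq, not_lt] at hy
    linarith
  simp [profile, Real.sqrt_eq_zero_of_nonpos this]

theorem rhoW_eq : rhoW a b = fun y => (b * ellipticK (eccentricity a b))⁻¹ * profile a b y := by
  ext y
  simp [rhoW, profile, mul_comm]

theorem rhoT_eq :
    rhoT a b = fun y => (b * ellipticD (eccentricity a b))⁻¹ * (y 0 * profile a b y) := by
  ext y
  simp only [rhoT, profile, div_eq_mul_inv, mul_inv]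
  ring

theorem abs_coord_le (ha : 0 < a) {y : EuclideanSpace ℝ (Fin 2)} (hy : y ∈ ellipticDisk a b) :
    |y 0| ≤ a := by
  have h1 : y 0 ^ 2 / a ^ 2 < 1 := lt_of_le_of_lt (by simp; positivity) hy
  rw [div_lt_one (by positivity)] at h1
  exact abs_le_of_sq_le_sq h1.le ha.le

theorem abs_coord_mul_profile_le (ha : 0 < a) (y : EuclideanSpace ℝ (Fin 2)) :
    |y 0 * profile a b y| ≤ a * profile a b y := by
  by_cases hy : y ∈ ellipticDisk a b
  · rw [abs_mul, abs_of_nonneg (profile_nonneg y)]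
    exact mul_le_mul_of_nonneg_right (abs_coord_le ha hy) (profile_nonneg y)
  · simp [profile_eq_zero hy]

/-- The parameter of the midpoint of the chord through `x` in the direction `(u, 1)`. -/
noncomputable def chordMid (a b : ℝ) (x : EuclideanSpace ℝ (Fin 2)) (u : ℝ) : ℝ :=
  -(x 0 * u / a ^ 2 + x 1 / b ^ 2) / (u ^ 2 / a ^ 2 + 1 / b ^ 2)

theorem slope_pos (hb : 0 < b) (u : ℝ) : 0 < u ^ 2 / a ^ 2 + 1 / b ^ 2 := by positivity

/-- Completing the square in `h`: the point `x` enters only through the midpoint and the constant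
term, not through the leading coefficient. -/
theorem profile_chord (hb : 0 < b) (x : EuclideanSpace ℝ (Fin 2)) (u h : ℝ) :
    profile a b (x + !₂[h * u, h]) =
      (√((1 - x 0 ^ 2 / a ^ 2 - x 1 ^ 2 / b ^ 2 +
          (u ^ 2 / a ^ 2 + 1 / b ^ 2) * chordMid a b x u ^ 2) -
        (u ^ 2 / a ^ 2 + 1 / b ^ 2) * (h - chordMid a b x u) ^ 2))⁻¹ := by
  have hm : (u ^ 2 / a ^ 2 + 1 / b ^ 2) * chordMid a b x u = -(x 0 * u / a ^ 2 + x 1 / b ^ 2) :=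
    mul_div_cancel₀ _ (slope_pos hb u).ne'
  simp only [profile, PiLp.add_apply, Matrix.cons_val_zero, Matrix.cons_val_one]
  congr 2
  linear_combination (-2 * h) * hm

theorem chord_radius_pos (hb : 0 < b) {x : EuclideanSpace ℝ (Fin 2)} (hx : x ∈ ellipticDisk a b)
    (u : ℝ) : 0 < 1 - x 0 ^ 2 / a ^ 2 - x 1 ^ 2 / b ^ 2 +
      (u ^ 2 / a ^ 2 + 1 / b ^ 2) * chordMid a b x u ^ 2 := by
  have : 0 < 1 - x 0 ^ 2 / a ^ 2 - x 1 ^ 2 / b ^ 2 := by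
    have : x 0 ^ 2 / a ^ 2 + x 1 ^ 2 / b ^ 2 < 1 := hx
    linarith
  have := slope_pos (a := a) hb u
  positivity

theorem integrable_profile_chord (hb : 0 < b) {x : EuclideanSpace ℝ (Fin 2)}
    (hx : x ∈ ellipticDisk a b) (u : ℝ) :
    Integrable fun h : ℝ => profile a b (x + !₂[h * u, h]) := by
  simp_rw [profile_chord hb]
  exact integrable_inv_sqrt_sub_mul_sq (chord_radius_pos hb hx u) (slope_pos hb u) _

theorem integral_profile_chord (hb : 0 < b) {x : EuclideanSpace ℝ (Fin 2)}
    (hx : x ∈ ellipticDisk a b) (u : ℝ) :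
    ∫ h : ℝ, profile a b (x + !₂[h * u, h]) =
      Real.pi * (√(u ^ 2 / a ^ 2 + 1 / b ^ 2))⁻¹ := by
  simp_rw [profile_chord hb]
  exact integral_inv_sqrt_sub_mul_sq (chord_radius_pos hb hx u) (slope_pos hb u) _

theorem integral_coord_mul_profile_chord (hb : 0 < b) {x : EuclideanSpace ℝ (Fin 2)}
    (hx : x ∈ ellipticDisk a b) (u : ℝ) :
    ∫ h : ℝ, (x 0 + h * u) * profile a b (x + !₂[h * u, h]) =
      Real.pi / b ^ 2 * (x 0 - x 1 * u) * (√(u ^ 2 / a ^ 2 + 1 / b ^ 2))⁻¹ ^ 3 := by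
  have h1 := integrable_profile_chord hb hx u
  have h2 := integral_profile_chord hb hx u
  have h3 := integrable_sub_mul_inv_sqrt_sub_mul_sq (chord_radius_pos hb hx u)
    (slope_pos (a := a) hb u) (chordMid a b x u)
  have h4 := integral_sub_mul_inv_sqrt_sub_mul_sq (1 - x 0 ^ 2 / a ^ 2 - x 1 ^ 2 / b ^ 2 +
      (u ^ 2 / a ^ 2 + 1 / b ^ 2) * chordMid a b x u ^ 2) (u ^ 2 / a ^ 2 + 1 / b ^ 2)
      (chordMid a b x u)
  simp_rw [← profile_chord hb] at h3 h4
  -- Split the coordinate into its value at the midpoint of the chord and a part odd about the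
  -- midpoint, which integrates to zero.
  have : ∀ h : ℝ, (x 0 + h * u) * profile a b (x + !₂[h * u, h]) =
      (x 0 + chordMid a b x u * u) * profile a b (x + !₂[h * u, h]) +
      u * ((h - chordMid a b x u) * profile a b (x + !₂[h * u, h])) := fun h => by ring
  simp_rw [this]
  rw [integral_add (h1.const_mul _) (h3.const_mul _), integral_const_mul, integral_const_mul, h2,
    h4]
  have hq := slope_pos (a := a) hb u
  have hs := Real.sqrt_pos.2 hq
  have hr : √(u ^ 2 / a ^ 2 + 1 / b ^ 2) ^ 2 = u ^ 2 / a ^ 2 + 1 / b ^ 2 := Real.sq_sqrt hq.le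
  have hm : x 0 + chordMid a b x u * u =
      (x 0 - x 1 * u) / b ^ 2 * (√(u ^ 2 / a ^ 2 + 1 / b ^ 2))⁻¹ ^ 2 := by
    rw [inv_pow, hr, chordMid]
    field_simp
    ring
  rw [hm]; ring

theorem norm_vec_slope (u h : ℝ) : ‖!₂[h * u, h]‖ = |h| * √(1 + u ^ 2) := by
  rw [EuclideanSpace.norm_eq, ← Real.sqrt_sq_eq_abs, ← Real.sqrt_mul (sq_nonneg h)]
  congr 1
  simp
  ring

/-- The Jacobian `|h|` cancels the `|h|` in the distance. At `h = 0` this can fail, because the left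
side is then zero. -/
theorem abs_mul_kernel_chord (x : EuclideanSpace ℝ (Fin 2)) (g : EuclideanSpace ℝ (Fin 2) → ℝ)
    {u h : ℝ} (hh : h ≠ 0) : |h| * (g (x + !₂[h * u, h]) / ‖x - (x + !₂[h * u, h])‖) =
      (√(1 + u ^ 2))⁻¹ * g (x + !₂[h * u, h]) := by
  rw [sub_add_cancel_left, norm_neg, norm_vec_slope]
  have := abs_pos.2 hh
  have : 0 < √(1 + u ^ 2) := by positivity
  field_simp

theorem ae_snd_ne_zero : ∀ᵐ p : ℝ × ℝ, p.2 ≠ 0 := by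
  rw [Measure.volume_eq_prod]
  exact Measure.quasiMeasurePreserving_snd.ae (Measure.ae_ne volume 0)

theorem integrable_kernel_chord_iff (x : EuclideanSpace ℝ (Fin 2))
    {g : EuclideanSpace ℝ (Fin 2) → ℝ} (hg : Measurable g) :
    Integrable (fun y => g y / ‖x - y‖) ↔
      Integrable fun p : ℝ × ℝ => (√(1 + p.1 ^ 2))⁻¹ * g (x + !₂[p.2 * p.1, p.2]) := by
  rw [integrable_plane_cone_iff x (by fun_prop)]
  refine integrable_congr ?_
  filter_upwards [ae_snd_ne_zero] with p hp using abs_mul_kernel_chord x g hp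

theorem integral_kernel_chord (x : EuclideanSpace ℝ (Fin 2))
    {g : EuclideanSpace ℝ (Fin 2) → ℝ} (hg : Measurable g)
    (hi : Integrable (fun y => g y / ‖x - y‖)) :
    ∫ y, g y / ‖x - y‖ = ∫ u, (√(1 + u ^ 2))⁻¹ * ∫ h, g (x + !₂[h * u, h]) := by
  rw [integral_plane_cone x (by fun_prop)]
  have : ∫ p : ℝ × ℝ, |p.2| * (g (x + !₂[p.2 * p.1, p.2]) / ‖x - (x + !₂[p.2 * p.1, p.2])‖) =
      ∫ p : ℝ × ℝ, (√(1 + p.1 ^ 2))⁻¹ * g (x + !₂[p.2 * p.1, p.2]) := by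
    refine integral_congr_ae ?_
    filter_upwards [ae_snd_ne_zero] with p hp using abs_mul_kernel_chord x g hp
  rw [this, Measure.volume_eq_prod, integral_prod]
  · simp_rw [integral_const_mul]
  · exact (integrable_kernel_chord_iff x hg).1 hi

theorem integrable_profile_kernel (hb : 0 < b) (hab : b ≤ a) {x : EuclideanSpace ℝ (Fin 2)}
    (hx : x ∈ ellipticDisk a b) : Integrable fun y => profile a b y / ‖x - y‖ := by
  rw [integrable_kernel_chord_iff x measurable_profile, Measure.volume_eq_prod,
    integrable_prod_iff]
  · refine ⟨.of_forall fun u => (integrable_profile_chord hb hx u).const_mul (√(1 + u ^ 2))⁻¹, ?_⟩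
    have : ∀ u h : ℝ, ‖(√(1 + u ^ 2))⁻¹ * profile a b (x + !₂[h * u, h])‖ =
        (√(1 + u ^ 2))⁻¹ * profile a b (x + !₂[h * u, h]) := fun u h =>
      Real.norm_of_nonneg (mul_nonneg (by positivity) (profile_nonneg _))
    refine ((integrable_slope hb hab).const_mul Real.pi).congr (.of_forall fun u => ?_)
    simp only [this]
    rw [integral_const_mul, integral_profile_chord hb hx]
    ring
  · refine Measurable.aestronglyMeasurable (.mul (by fun_prop) (measurable_profile.comp ?_))
    exact measurable_const.add (continuous_vec2.measurable.comp
      (f := fun p : ℝ × ℝ => (p.2 * p.1, p.2)) (by fun_prop))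

theorem integral_profile_kernel (hb : 0 < b) (hab : b ≤ a) {x : EuclideanSpace ℝ (Fin 2)}
    (hx : x ∈ ellipticDisk a b) :
    ∫ y, profile a b y / ‖x - y‖ = 2 * Real.pi * b * ellipticK (eccentricity a b) := by
  rw [integral_kernel_chord x measurable_profile (integrable_profile_kernel hb hab hx)]
  simp_rw [integral_profile_chord hb hx]
  have := integral_slope_eq_ellipticK hb hab
  calc _ = ∫ u : ℝ, Real.pi * ((√(1 + u ^ 2))⁻¹ * (√(u ^ 2 / a ^ 2 + 1 / b ^ 2))⁻¹) := by
        congr with u; ring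
    _ = _ := by rw [integral_const_mul, this]; ring

theorem integrable_coord_mul_profile_kernel (hb : 0 < b) (hab : b ≤ a)
    {x : EuclideanSpace ℝ (Fin 2)} (hx : x ∈ ellipticDisk a b) :
    Integrable fun y => y 0 * profile a b y / ‖x - y‖ := by
  refine ((integrable_profile_kernel hb hab hx).const_mul a).mono'
    (Measurable.div (by fun_prop) (by fun_prop)).aestronglyMeasurable (.of_forall fun y => ?_)
  rw [norm_div, norm_norm, ← mul_div_assoc]
  exact div_le_div_of_nonneg_right (abs_coord_mul_profile_le (hb.trans_le hab) y) (norm_nonneg _)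

theorem integral_coord_mul_profile_kernel (hb : 0 < b) (hab : b ≤ a)
    {x : EuclideanSpace ℝ (Fin 2)} (hx : x ∈ ellipticDisk a b) :
    ∫ y, y 0 * profile a b y / ‖x - y‖ =
      2 * Real.pi * b * ellipticD (eccentricity a b) * x 0 := by
  have hi := integrable_coord_mul_profile_kernel hb hab hx
  have hg : Measurable fun y : EuclideanSpace ℝ (Fin 2) => y 0 * profile a b y := by fun_prop
  have hF : Integrable fun u : ℝ => (√(1 + u ^ 2))⁻¹ *
      (Real.pi / b ^ 2 * (x 0 - x 1 * u) * (√(u ^ 2 / a ^ 2 + 1 / b ^ 2))⁻¹ ^ 3) := by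
    have := (integrable_kernel_chord_iff x hg).1 hi
    rw [Measure.volume_eq_prod] at this
    refine this.integral_prod_left.congr (.of_forall fun u => ?_)
    simp only [integral_const_mul]
    rw [← integral_coord_mul_profile_chord hb hx]
    simp
  have key : ∫ y, y 0 * profile a b y / ‖x - y‖ = ∫ u : ℝ, (√(1 + u ^ 2))⁻¹ *
      (Real.pi / b ^ 2 * (x 0 - x 1 * u) * (√(u ^ 2 / a ^ 2 + 1 / b ^ 2))⁻¹ ^ 3) := by
    rw [integral_kernel_chord x hg hi]
    congr with u
    rw [← integral_coord_mul_profile_chord hb hx]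
    simp
  rw [key]
  -- Adding the integrand reflected in `u` removes the term `x 1 * u`; only integrability of the
  -- whole integrand is used, not of its two terms.
  have hneg := integral_neg_eq_self (fun u : ℝ => (√(1 + u ^ 2))⁻¹ *
      (Real.pi / b ^ 2 * (x 0 - x 1 * u) * (√(u ^ 2 / a ^ 2 + 1 / b ^ 2))⁻¹ ^ 3)) volume
  have hsum := integral_add hF.comp_neg hF
  rw [hneg] at hsum
  have : ∫ u : ℝ, (√(1 + (-u) ^ 2))⁻¹ *
      (Real.pi / b ^ 2 * (x 0 - x 1 * -u) * (√((-u) ^ 2 / a ^ 2 + 1 / b ^ 2))⁻¹ ^ 3) +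
      (√(1 + u ^ 2))⁻¹ *
      (Real.pi / b ^ 2 * (x 0 - x 1 * u) * (√(u ^ 2 / a ^ 2 + 1 / b ^ 2))⁻¹ ^ 3) =
      2 * (Real.pi / b ^ 2 * x 0) * (2 * b ^ 3 * ellipticD (eccentricity a b)) := by
    rw [← integral_slope_eq_ellipticD hb hab, ← integral_const_mul]
    congr with u
    rw [neg_sq]; ring
  rw [this] at hsum
  have e : 2 * Real.pi * b * ellipticD (eccentricity a b) * x 0 =
    (2 * (Real.pi / b ^ 2 * x 0) * (2 * b ^ 3 * ellipticD (eccentricity a b))) / 2 := by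
    field_simp
  rw [e]
  linarith

end PlanePotential

/-! ### Differentiation of layers under the integral -/

section Layer

variable {G : Type} [NormedAddCommGroup G] [NormedSpace ℝ G]
  {A : Set (EuclideanSpace ℝ (Fin 2))} {ρ : EuclideanSpace ℝ (Fin 2) → ℝ}

/-- The superposition of the translates of the kernel `k` with density `ρ` on the plane set `A`. -/
noncomputable def layer (A : Set (EuclideanSpace ℝ (Fin 2))) (ρ : EuclideanSpace ℝ (Fin 2) → ℝ)
    (k : EuclideanSpace ℝ (Fin 3) → G) (x : EuclideanSpace ℝ (Fin 3)) : G :=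
  ∫ y in A, ρ y • k (x - lift3 y 0)

/-- The complement in space of the closed plane set `closure A`. -/
def offLayer (A : Set (EuclideanSpace ℝ (Fin 2))) : Set (EuclideanSpace ℝ (Fin 3)) :=
  ((fun y => lift3 y 0) '' closure A)ᶜ

theorem continuous_lift3_zero : Continuous fun y => lift3 y 0 :=
  continuous_lift3.comp (continuous_id.prodMk continuous_const)

theorem isCompact_image_closure (hA : Bornology.IsBounded A) :
    IsCompact ((fun y => lift3 y 0) '' closure A) :=
  hA.isCompact_closure.image continuous_lift3_zero

theorem isOpen_offLayer (hA : Bornology.IsBounded A) : IsOpen (offLayer A) :=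
  (isCompact_image_closure hA).isClosed.isOpen_compl

theorem sub_lift3_ne_zero {x : EuclideanSpace ℝ (Fin 3)} (hx : x ∈ offLayer A)
    {y : EuclideanSpace ℝ (Fin 2)} (hy : y ∈ A) : x - lift3 y 0 ≠ 0 := by
  rw [sub_ne_zero]
  rintro rfl
  exact hx ⟨y, subset_closure hy, rfl⟩

/-- The differences between a small closed ball and the compact layer form a compact set avoiding
`0`, where `k` is bounded. This one bound dominates every passage to the limit under the integral
off the layer. -/
theorem exists_bound_near (hA : Bornology.IsBounded A) {k : EuclideanSpace ℝ (Fin 3) → G}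
    (hk : ContinuousOn k {0}ᶜ) {x : EuclideanSpace ℝ (Fin 3)} (hx : x ∈ offLayer A) :
    ∃ r > 0, ∃ M, ∀ x' ∈ Metric.ball x r, x' ∈ offLayer A ∧
      ∀ y ∈ A, ‖k (x' - lift3 y 0)‖ ≤ M := by
  obtain ⟨r, hr, hsub⟩ := Metric.nhds_basis_closedBall.mem_iff.1
    ((isOpen_offLayer hA).mem_nhds hx)
  have hc := ((isCompact_closedBall x r).prod (isCompact_image_closure hA)).image continuous_sub
  obtain ⟨M, hM⟩ := hc.exists_bound_of_continuousOn (f := k) (hk.mono (by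
    rintro _ ⟨⟨x', z⟩, ⟨hx', hz⟩, rfl⟩ h0
    exact hsub hx' (by rwa [sub_eq_zero.1 h0])))
  exact ⟨r, hr, M, fun x' hx' => ⟨hsub (Metric.ball_subset_closedBall hx'), fun y hy =>
    hM _ ⟨(x', lift3 y 0), ⟨Metric.ball_subset_closedBall hx', y, subset_closure hy, rfl⟩, rfl⟩⟩⟩

theorem aestronglyMeasurable_layer (hAm : MeasurableSet A)
    (hρ : IntegrableOn ρ A) {k : EuclideanSpace ℝ (Fin 3) → G} (hk : ContinuousOn k {0}ᶜ)
    {x : EuclideanSpace ℝ (Fin 3)} (hx : x ∈ offLayer A) :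
    AEStronglyMeasurable (fun y => ρ y • k (x - lift3 y 0)) (volume.restrict A) :=
  hρ.aestronglyMeasurable.smul <| ContinuousOn.aestronglyMeasurable (hk.comp
    (continuous_const.sub continuous_lift3_zero).continuousOn
    fun _ hy => sub_lift3_ne_zero hx hy) hAm

theorem integrable_layer (hA : Bornology.IsBounded A) (hAm : MeasurableSet A)
    (hρ : IntegrableOn ρ A) {k : EuclideanSpace ℝ (Fin 3) → G} (hk : ContinuousOn k {0}ᶜ)
    {x : EuclideanSpace ℝ (Fin 3)} (hx : x ∈ offLayer A) :
    IntegrableOn (fun y => ρ y • k (x - lift3 y 0)) A := by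
  obtain ⟨r, hr, M, hM⟩ := exists_bound_near hA hk hx
  refine (hρ.norm.mul_const M).mono' (aestronglyMeasurable_layer hAm hρ hk hx) ?_
  filter_upwards [ae_restrict_mem hAm] with y hy
  rw [norm_smul]
  exact mul_le_mul_of_nonneg_left ((hM x (Metric.mem_ball_self hr)).2 y hy) (norm_nonneg _)

theorem continuousOn_layer (hA : Bornology.IsBounded A) (hAm : MeasurableSet A)
    (hρ : IntegrableOn ρ A) {k : EuclideanSpace ℝ (Fin 3) → G} (hk : ContinuousOn k {0}ᶜ) :
    ContinuousOn (layer A ρ k) (offLayer A) := by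
  intro x hx
  refine ContinuousAt.continuousWithinAt ?_
  obtain ⟨r, hr, M, hM⟩ := exists_bound_near hA hk hx
  have hball := Metric.ball_mem_nhds x hr
  refine continuousAt_of_dominated (bound := fun y => ‖ρ y‖ * M) ?_ ?_ (hρ.norm.mul_const M) ?_
  · filter_upwards [hball] with x' hx' using aestronglyMeasurable_layer hAm hρ hk (hM x' hx').1
  · filter_upwards [hball] with x' hx'
    filter_upwards [ae_restrict_mem hAm] with y hy
    rw [norm_smul]
    exact mul_le_mul_of_nonneg_left ((hM x' hx').2 y hy) (norm_nonneg _)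
  · filter_upwards [ae_restrict_mem hAm] with y hy
    refine ContinuousAt.const_smul (c := ρ y) ?_
    exact ContinuousAt.comp (f := fun x' => x' - lift3 y 0) (hk.continuousAt
      (isOpen_compl_singleton.mem_nhds (sub_lift3_ne_zero hx hy))) (by fun_prop)

theorem hasFDerivAt_layer (hA : Bornology.IsBounded A) (hAm : MeasurableSet A)
    (hρ : IntegrableOn ρ A) {k : EuclideanSpace ℝ (Fin 3) → G} (hk : ContDiffOn ℝ 1 k {0}ᶜ)
    {x : EuclideanSpace ℝ (Fin 3)} (hx : x ∈ offLayer A) :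
    HasFDerivAt (layer A ρ k) (layer A ρ (fderiv ℝ k) x) x := by
  have hk' : ContinuousOn (fderiv ℝ k) {0}ᶜ :=
    hk.continuousOn_fderiv_of_isOpen isOpen_compl_singleton le_rfl
  obtain ⟨r, hr, M, hM⟩ := exists_bound_near hA hk' hx
  have hball := Metric.ball_mem_nhds x hr
  refine hasFDerivAt_integral_of_dominated_of_fderiv_le (s := Metric.ball x r)
    (bound := fun y => ‖ρ y‖ * M) (F' := fun x y => ρ y • fderiv ℝ k (x - lift3 y 0))
    hball ?_ (integrable_layer hA hAm hρ hk.continuousOn hx)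
    (aestronglyMeasurable_layer hAm hρ hk' hx) ?_ (hρ.norm.mul_const M) ?_
  · filter_upwards [hball] with x' hx' using
      aestronglyMeasurable_layer hAm hρ hk.continuousOn (hM x' hx').1
  · filter_upwards [ae_restrict_mem hAm] with y hy x' hx'
    rw [norm_smul]
    exact mul_le_mul_of_nonneg_left ((hM x' hx').2 y hy) (norm_nonneg _)
  · filter_upwards [ae_restrict_mem hAm] with y hy x' hx'
    have h1 : DifferentiableAt ℝ k (x' - lift3 y 0) :=
      (hk.contDiffAt (isOpen_compl_singleton.mem_nhds
        (sub_lift3_ne_zero (hM x' hx').1 hy))).differentiableAt one_ne_zero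
    exact (h1.hasFDerivAt.comp x' ((hasFDerivAt_id x').sub_const (lift3 y 0))).const_smul (ρ y)

/-- The derivative of a layer is the layer of the derived kernel, so induction on `n` works once the
target space `G` of the kernel may vary. -/
theorem contDiffOn_layer (hA : Bornology.IsBounded A) (hAm : MeasurableSet A)
    (hρ : IntegrableOn ρ A) {k : EuclideanSpace ℝ (Fin 3) → G} {n : ℕ}
    (hk : ContDiffOn ℝ n k {0}ᶜ) : ContDiffOn ℝ n (layer A ρ k) (offLayer A) := by
  induction n generalizing G with
  | zero => exact contDiffOn_zero.2 (continuousOn_layer hA hAm hρ hk.continuousOn)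
  | succ n ih =>
    have h1 : ContDiffOn ℝ 1 k {0}ᶜ := hk.of_le (by simp)
    push_cast at hk ⊢
    refine (contDiffOn_succ_iff_fderiv_of_isOpen (isOpen_offLayer hA)).2
      ⟨fun x hx => (hasFDerivAt_layer hA hAm hρ h1 hx).differentiableAt.differentiableWithinAt,
        by simp, ?_⟩
    refine (ih ((contDiffOn_succ_iff_fderiv_of_isOpen isOpen_compl_singleton).1 hk).2.2).congr ?_
    exact fun x hx => (hasFDerivAt_layer hA hAm hρ h1 hx).fderiv

theorem laplacian_layer (hA : Bornology.IsBounded A) (hAm : MeasurableSet A)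
    (hρ : IntegrableOn ρ A) {k : EuclideanSpace ℝ (Fin 3) → ℝ} (hk : ContDiffOn ℝ 2 k {0}ᶜ)
    {x : EuclideanSpace ℝ (Fin 3)} (hx : x ∈ offLayer A) :
    Laplacian.laplacian (layer A ρ k) x = layer A ρ (Laplacian.laplacian k) x := by
  have hk1 : ContDiffOn ℝ 1 k {0}ᶜ := hk.of_le (by norm_num)
  have hk2 : ContDiffOn ℝ 1 (fderiv ℝ k) {0}ᶜ :=
    hk.fderiv_of_isOpen isOpen_compl_singleton (by norm_num)
  have hk3 : ContinuousOn (fderiv ℝ (fderiv ℝ k)) {0}ᶜ :=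
    hk2.continuousOn_fderiv_of_isOpen isOpen_compl_singleton le_rfl
  have h1 : fderiv ℝ (layer A ρ k) =ᶠ[𝓝 x] layer A ρ (fderiv ℝ k) := by
    filter_upwards [(isOpen_offLayer hA).mem_nhds hx] with x' hx'
    exact (hasFDerivAt_layer hA hAm hρ hk1 hx').fderiv
  have h2 := h1.fderiv_eq.trans (hasFDerivAt_layer hA hAm hρ hk2 hx).fderiv
  have hint := integrable_layer
    (G := EuclideanSpace ℝ (Fin 3) →L[ℝ] EuclideanSpace ℝ (Fin 3) →L[ℝ] ℝ) hA hAm hρ hk3 hx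
  simp only [InnerProductSpace.laplacian_eq_iteratedFDeriv_orthonormalBasis _
    (EuclideanSpace.basisFun (Fin 3) ℝ), iteratedFDeriv_two_apply, h2, layer,
    Matrix.cons_val_zero, Matrix.cons_val_one, smul_eq_mul, Finset.mul_sum]
  rw [integral_finsetSum]
  · refine Finset.sum_congr rfl fun i _ => ?_
    rw [ContinuousLinearMap.integral_apply hint,
      ContinuousLinearMap.integral_apply (hint.apply_continuousLinearMap _)]
    rfl
  · exact fun i _ => (hint.apply_continuousLinearMap (EuclideanSpace.basisFun (Fin 3) ℝ i)
      ).apply_continuousLinearMap (EuclideanSpace.basisFun (Fin 3) ℝ i)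

end Layer

/-! ### The Newton kernel and its derivatives -/

section Newton

/-- The Newton kernel in space. -/
noncomputable def newton (v : EuclideanSpace ℝ (Fin 3)) : ℝ := ‖v‖⁻¹

/-- The gradient of the Newton kernel. -/
noncomputable def newtonGrad (v : EuclideanSpace ℝ (Fin 3)) : EuclideanSpace ℝ (Fin 3) :=
  -(‖v‖ ^ 3)⁻¹ • v

theorem contDiffOn_newton {n : WithTop ℕ∞} : ContDiffOn ℝ n newton {0}ᶜ := fun _ hv =>
  ((contDiffAt_norm ℝ hv).inv (norm_ne_zero_iff.2 hv)).contDiffWithinAt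

theorem continuousOn_newtonGrad : ContinuousOn newtonGrad {0}ᶜ := by
  refine ContinuousOn.smul (f := fun v => -(‖v‖ ^ 3)⁻¹) (ContinuousOn.neg
    (ContinuousOn.inv₀ (by fun_prop) fun v hv => ?_)) continuousOn_id
  exact pow_ne_zero 3 (norm_ne_zero_iff.2 hv)

theorem measurable_newtonGrad : Measurable newtonGrad := by
  unfold newtonGrad
  fun_prop

/-- Real powers of `‖w‖ ^ 2` serve both orders of derivative: exponent `-1/2` is the Newton kernel
and `-3/2` the coefficient of its derivative. -/
theorem hasFDerivAt_rpow_norm_sq (p : ℝ) {v : EuclideanSpace ℝ (Fin 3)} (hv : v ≠ 0) :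
    HasFDerivAt (fun w : EuclideanSpace ℝ (Fin 3) => (‖w‖ ^ 2) ^ p)
      ((2 * p * (‖v‖ ^ 2) ^ (p - 1)) • innerSL ℝ v) v := by
  have h := (Real.hasDerivAt_rpow_const (p := p)
    (Or.inl (pow_ne_zero 2 (norm_ne_zero_iff.2 hv)))).comp_hasFDerivAt v
    (hasStrictFDerivAt_norm_sq v).hasFDerivAt
  refine h.congr_fderiv ?_
  ext w
  simp
  ring

theorem newton_eq_rpow : newton = fun v => (‖v‖ ^ 2) ^ (-(1 / 2) : ℝ) := by
  ext v
  rw [newton, Real.rpow_neg (by positivity), ← Real.sqrt_eq_rpow, Real.sqrt_sq (norm_nonneg _)]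

theorem rpow_norm_sq_neg_three_half (v : EuclideanSpace ℝ (Fin 3)) :
    (‖v‖ ^ 2) ^ (-(3 / 2) : ℝ) = (‖v‖ ^ 3)⁻¹ := by
  rw [Real.rpow_neg (by positivity), ← Real.rpow_natCast, ← Real.rpow_mul (norm_nonneg _),
    ← Real.rpow_natCast]
  norm_num

theorem fderiv_newton {v : EuclideanSpace ℝ (Fin 3)} (hv : v ≠ 0) :
    fderiv ℝ newton v = (-(‖v‖ ^ 2) ^ (-(3 / 2) : ℝ)) • innerSL ℝ v := by
  rw [newton_eq_rpow, (hasFDerivAt_rpow_norm_sq _ hv).fderiv]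
  norm_num

theorem fderiv_newton_apply {v : EuclideanSpace ℝ (Fin 3)} (hv : v ≠ 0)
    (w : EuclideanSpace ℝ (Fin 3)) : fderiv ℝ newton v w = inner ℝ w (newtonGrad v) := by
  rw [fderiv_newton hv, rpow_norm_sq_neg_three_half, newtonGrad, inner_smul_right]
  simp [real_inner_comm]

theorem fderiv_fderiv_newton_apply {v : EuclideanSpace ℝ (Fin 3)} (hv : v ≠ 0)
    (w w' : EuclideanSpace ℝ (Fin 3)) :
    fderiv ℝ (fderiv ℝ newton) v w w' = 3 * (‖v‖ ^ 2) ^ (-(5 / 2) : ℝ) * inner ℝ v w *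
      inner ℝ v w' - (‖v‖ ^ 2) ^ (-(3 / 2) : ℝ) * inner ℝ w w' := by
  have h1 : fderiv ℝ newton =ᶠ[𝓝 v] fun v => (-(‖v‖ ^ 2) ^ (-(3 / 2) : ℝ)) • innerSL ℝ v := by
    filter_upwards [isOpen_compl_singleton.mem_nhds hv] with v hv using fderiv_newton hv
  have h2 := (hasFDerivAt_rpow_norm_sq (-(3 / 2)) hv).neg.smul
    ((innerSL ℝ : EuclideanSpace ℝ (Fin 3) →L[ℝ] _).hasFDerivAt (x := v))
  rw [h1.fderiv_eq]
  erw [h2.fderiv]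
  simp
  rw [innerSL_apply_apply, innerSL_apply_apply]
  norm_num
  ring

/-- The rank-one part of the Hessian has trace `3 ‖v‖⁻³`, and the multiple of the identity
contributes minus the dimension times `‖v‖⁻³`; they cancel because the dimension is three. -/
theorem laplacian_newton {v : EuclideanSpace ℝ (Fin 3)} (hv : v ≠ 0) :
    Laplacian.laplacian newton v = 0 := by
  simp only [InnerProductSpace.laplacian_eq_iteratedFDeriv_orthonormalBasis _
    (EuclideanSpace.basisFun (Fin 3) ℝ), iteratedFDeriv_two_apply, Matrix.cons_val_zero,
    Matrix.cons_val_one, fderiv_fderiv_newton_apply hv]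
  have h0 : 0 < ‖v‖ ^ 2 := by positivity
  have h1 : (‖v‖ ^ 2) ^ (-(3 / 2) : ℝ) = (‖v‖ ^ 2) ^ (-(5 / 2) : ℝ) * ‖v‖ ^ 2 := by
    rw [← Real.rpow_add_one h0.ne']; norm_num
  rw [h1]
  have h2 : ‖v‖ ^ 2 = v 0 ^ 2 + v 1 ^ 2 + v 2 ^ 2 := by
    simp [EuclideanSpace.norm_sq_eq, Fin.sum_univ_three]
  generalize (‖v‖ ^ 2) ^ (-(5 / 2) : ℝ) = c
  simp [Fin.sum_univ_three, EuclideanSpace.inner_single_right]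
  rw [h2]
  ring

end Newton

/-! ### Harmonicity, gradient and Neumann condition -/

section SingleLayer

variable {A : Set (EuclideanSpace ℝ (Fin 2))} {ρ : EuclideanSpace ℝ (Fin 2) → ℝ}

theorem singleLayer_eq : singleLayer A ρ = (1 / (2 * Real.pi)) • layer A ρ newton := rfl

theorem mem_offLayer {x : EuclideanSpace ℝ (Fin 3)} (hx : x 2 ≠ 0) : x ∈ offLayer A := by
  rintro ⟨y, _, rfl⟩
  exact hx (by simp [lift3])

theorem harmonicOnNhd_singleLayer (hA : Bornology.IsBounded A) (hAm : MeasurableSet A)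
    (hρ : IntegrableOn ρ A) :
    InnerProductSpace.HarmonicOnNhd (singleLayer A ρ) (offLayer A) := by
  intro x hx
  have hV := (isOpen_offLayer hA).mem_nhds hx
  have h : InnerProductSpace.HarmonicAt (layer A ρ newton) x := by
    refine ⟨(contDiffOn_layer hA hAm hρ (n := 2) contDiffOn_newton).contDiffAt hV, ?_⟩
    filter_upwards [hV] with x' hx'
    rw [laplacian_layer hA hAm hρ contDiffOn_newton hx', layer]
    refine (setIntegral_congr_fun hAm fun y hy => ?_).trans (integral_zero _ _)
    simp only [laplacian_newton (sub_lift3_ne_zero hx' hy), smul_zero]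
  rw [singleLayer_eq]
  exact h.const_smul

theorem gradient_singleLayer (hA : Bornology.IsBounded A) (hAm : MeasurableSet A)
    (hρ : IntegrableOn ρ A) {x : EuclideanSpace ℝ (Fin 3)} (hx : x ∈ offLayer A) :
    ∇ (singleLayer A ρ) x = (1 / (2 * Real.pi)) • layer A ρ newtonGrad x := by
  refine HasGradientAt.gradient ?_
  rw [hasGradientAt_iff_hasFDerivAt, singleLayer_eq]
  refine ((hasFDerivAt_layer hA hAm hρ contDiffOn_newton hx).const_smul _).congr_fderiv ?_
  ext w
  have hint := integrable_layer hA hAm hρ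
    (contDiffOn_newton (n := 1) |>.continuousOn_fderiv_of_isOpen isOpen_compl_singleton le_rfl) hx
  rw [InnerProductSpace.toDual_apply_apply, real_inner_comm, inner_smul_right, layer, layer,
    ← integral_inner (integrable_layer hA hAm hρ continuousOn_newtonGrad hx) w,
    _root_.smul_apply, ContinuousLinearMap.integral_apply hint, smul_eq_mul]
  congr 1
  refine setIntegral_congr_fun hAm fun y hy => ?_
  simp only [_root_.smul_apply, fderiv_newton_apply (sub_lift3_ne_zero hx hy),
    inner_smul_right, smul_eq_mul]

theorem singleLayer_lift3_neg (y : EuclideanSpace ℝ (Fin 2)) (s : ℝ) :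
    singleLayer A ρ (lift3 y (-s)) = singleLayer A ρ (lift3 y s) := by
  simp only [singleLayer]
  congr 2 with z
  simp [EuclideanSpace.norm_eq, Fin.sum_univ_three, lift3]

/-- Off the closed aperture the potential is differentiable, and it is even in the height, so its
vertical derivative equals its own negative. -/
theorem hasDerivAt_singleLayer_lift3 (hA : Bornology.IsBounded A) (hAm : MeasurableSet A)
    (hρ : IntegrableOn ρ A) {y : EuclideanSpace ℝ (Fin 2)} (hy : y ∉ closure A) :
    HasDerivAt (fun s : ℝ => singleLayer A ρ (lift3 y s)) 0 0 := by
  have hx : lift3 y 0 ∈ offLayer A := by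
    rintro ⟨z, hz, h⟩
    refine hy ?_
    convert hz
    ext i
    fin_cases i
    · simpa [lift3] using congrArg (fun v => v 0) h.symm
    · simpa [lift3] using congrArg (fun v => v 1) h.symm
  have hd : DifferentiableAt ℝ (fun s : ℝ => singleLayer A ρ (lift3 y s)) 0 := by
    refine DifferentiableAt.comp (f := fun s : ℝ => lift3 y s) 0
      ((harmonicOnNhd_singleLayer hA hAm hρ _ hx).1.differentiableAt two_ne_zero) ?_
    rw [differentiableAt_euclidean]
    intro i
    fin_cases i <;> simp [lift3]
  have h1 := hd.hasDerivAt
  have h2 : HasDerivAt (fun s : ℝ => singleLayer A ρ (lift3 y (-s)))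
      (deriv (fun s : ℝ => singleLayer A ρ (lift3 y s)) 0 * -1) 0 :=
    HasDerivAt.comp (h := fun s : ℝ => -s) (h₂ := fun s : ℝ => singleLayer A ρ (lift3 y s)) 0
      (by rw [neg_zero]; exact h1) (hasDerivAt_neg 0)
  simp only [singleLayer_lift3_neg] at h2
  have := h1.unique h2
  have h0 : deriv (fun s : ℝ => singleLayer A ρ (lift3 y s)) 0 = 0 := by linarith
  rwa [h0] at h1

end SingleLayer

/-! ### The plane inside space, and continuity of the potential at the aperture -/

theorem norm_lift3_sub_lift3 (y z : EuclideanSpace ℝ (Fin 2)) :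
    ‖lift3 y 0 - lift3 z 0‖ = ‖y - z‖ := by
  simp [EuclideanSpace.norm_eq, Fin.sum_univ_three, Fin.sum_univ_two, lift3]

theorem norm_lift3_sq (y : EuclideanSpace ℝ (Fin 2)) (s : ℝ) :
    ‖lift3 y s‖ ^ 2 = ‖y‖ ^ 2 + s ^ 2 := by
  simp [EuclideanSpace.norm_sq_eq, Fin.sum_univ_three, Fin.sum_univ_two, lift3]

theorem norm_le_norm_lift3 (y : EuclideanSpace ℝ (Fin 2)) (s : ℝ) : ‖y‖ ≤ ‖lift3 y s‖ := by
  refine le_of_sq_le_sq ?_ (norm_nonneg _)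
  rw [norm_lift3_sq]
  exact le_add_of_nonneg_right (sq_nonneg s)

/-- The vertical projection of space to the plane. -/
noncomputable def proj (x : EuclideanSpace ℝ (Fin 3)) : EuclideanSpace ℝ (Fin 2) := !₂[x 0, x 1]

theorem continuous_proj : Continuous proj :=
  continuous_vec2.comp (f := fun x : EuclideanSpace ℝ (Fin 3) => (x 0, x 1)) (by fun_prop)

theorem sub_lift3_proj_add (x : EuclideanSpace ℝ (Fin 3)) (v : EuclideanSpace ℝ (Fin 2)) :
    x - lift3 (proj x + v) 0 = lift3 (-v) (x 2) := by
  ext i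
  fin_cases i <;> simp [lift3, proj]

theorem integrableOn_inv_norm_ball (R : ℝ) :
    IntegrableOn (fun v : EuclideanSpace ℝ (Fin 2) => ‖v‖⁻¹) (Metric.ball 0 R) := by
  rw [integrableOn_fun_norm_addHaar volume (f := fun r : ℝ => r⁻¹)]
  refine (integrableOn_const (μ := volume) (s := Ioo 0 R) (C := (1 : ℝ)) (by simp)).congr_fun ?_
    measurableSet_Ioo
  intro r hr
  simp [mul_inv_cancel₀ hr.1.ne']

section Potential

variable {f : EuclideanSpace ℝ (Fin 2) → ℝ}

/-- Translation by `proj x` fixes the singularity at `v = 0` for all `x`, so the planar kernel `C /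
‖v‖` is a majorant independent of `x`. The radius `R + 1` allows `proj x` to move by less than `1`.
-/
theorem norm_bounded_kernel_le {C R : ℝ} (hC : ∀ y, ‖f y‖ ≤ C) {y₀ : EuclideanSpace ℝ (Fin 2)}
    (hR : ∀ y ∉ Metric.closedBall y₀ R, f y = 0) {x : EuclideanSpace ℝ (Fin 3)}
    (hx : proj x ∈ Metric.ball y₀ 1) {v : EuclideanSpace ℝ (Fin 2)} (hv0 : v ≠ 0) :
    ‖f (proj x + v) / ‖lift3 (-v) (x 2)‖‖ ≤
      (Metric.ball 0 (R + 1)).indicator (fun v => C * ‖v‖⁻¹) v := by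
  by_cases hv : v ∈ Metric.ball 0 (R + 1)
  · rw [indicator_of_mem hv, norm_div, norm_norm]
    have h1 : 0 < ‖v‖ := norm_pos_iff.2 hv0
    have h2 : ‖v‖ ≤ ‖lift3 (-v) (x 2)‖ := by simpa using norm_le_norm_lift3 (-v) (x 2)
    rw [div_eq_mul_inv]
    exact mul_le_mul (hC _) (inv_anti₀ h1 h2) (by positivity) ((norm_nonneg _).trans (hC 0))
  · rw [indicator_of_notMem hv, hR, zero_div, norm_zero]
    simp only [Metric.mem_ball, Metric.mem_closedBall, dist_zero_right, not_lt, not_le] at hv hx ⊢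
    have : ‖v‖ ≤ dist (proj x + v) y₀ + dist (proj x) y₀ := by
      rw [dist_eq_norm, dist_eq_norm]
      calc ‖v‖ = ‖(proj x + v - y₀) - (proj x - y₀)‖ := by congr 1; abel
        _ ≤ _ := norm_sub_le _ _
    linarith

theorem integrable_indicator_inv_norm (C R : ℝ) : Integrable
    ((Metric.ball (0 : EuclideanSpace ℝ (Fin 2)) R).indicator fun v => C * ‖v‖⁻¹) :=
  (integrable_indicator_iff measurableSet_ball).2 ((integrableOn_inv_norm_ball R).const_mul C)

theorem measurable_translated_kernel (hf : Continuous f) (x : EuclideanSpace ℝ (Fin 3)) :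
    AEStronglyMeasurable (fun v => f (proj x + v) / ‖lift3 (-v) (x 2)‖) volume := by
  refine (Measurable.div (hf.measurable.comp (measurable_const_add _)) ?_).aestronglyMeasurable
  exact (continuous_lift3.comp (continuous_neg.prodMk continuous_const)).norm.measurable

theorem continuousAt_translated_kernel (hf : Continuous f) (x : EuclideanSpace ℝ (Fin 3))
    {v : EuclideanSpace ℝ (Fin 2)} (hv : v ≠ 0) :
    ContinuousAt (fun x => f (proj x + v) / ‖lift3 (-v) (x 2)‖) x := by
  refine ContinuousAt.div (hf.comp (continuous_proj.add continuous_const)).continuousAt ?_ ?_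
  · exact (continuous_lift3.comp (f := fun x : EuclideanSpace ℝ (Fin 3) => (-v, x 2))
      (by fun_prop)).norm.continuousAt
  · have h2 : ‖v‖ ≤ ‖lift3 (-v) (x 2)‖ := by simpa using norm_le_norm_lift3 (-v) (x 2)
    exact ((norm_pos_iff.2 hv).trans_le h2).ne'

theorem integrable_kernel_of_bounded (hf : Continuous f) {C R : ℝ} (hC : ∀ y, ‖f y‖ ≤ C)
    {y₀ : EuclideanSpace ℝ (Fin 2)} (hR : ∀ y ∉ Metric.closedBall y₀ R, f y = 0)
    {x : EuclideanSpace ℝ (Fin 3)} (hx : proj x ∈ Metric.ball y₀ 1) :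
    Integrable fun y => f y / ‖x - lift3 y 0‖ := by
  rw [← (measurePreserving_add_left volume (proj x)).integrable_comp_emb
    (MeasurableEquiv.addLeft (proj x)).measurableEmbedding]
  refine (integrable_indicator_inv_norm C (R + 1)).mono' ?_ ?_
  · simpa only [Function.comp_def, sub_lift3_proj_add] using measurable_translated_kernel hf x
  · filter_upwards [Measure.ae_ne volume (0 : EuclideanSpace ℝ (Fin 2))] with v hv
    simpa only [Function.comp_def, sub_lift3_proj_add] using norm_bounded_kernel_le hC hR hx hv

theorem continuousAt_integral_kernel_of_bounded (hf : Continuous f) {C R : ℝ}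
    (hC : ∀ y, ‖f y‖ ≤ C) {y₀ : EuclideanSpace ℝ (Fin 2)}
    (hR : ∀ y ∉ Metric.closedBall y₀ R, f y = 0)
    {x : EuclideanSpace ℝ (Fin 3)} (hx : proj x ∈ Metric.ball y₀ 1) :
    ContinuousAt (fun x => ∫ y, f y / ‖x - lift3 y 0‖) x := by
  have h : (fun x => ∫ y, f y / ‖x - lift3 y 0‖) =
      fun x => ∫ v, f (proj x + v) / ‖lift3 (-v) (x 2)‖ := by
    ext x
    rw [← integral_add_left_eq_self _ (proj x)]
    simp only [sub_lift3_proj_add]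
  rw [h]
  refine continuousAt_of_dominated (.of_forall (measurable_translated_kernel hf)) ?_
    (integrable_indicator_inv_norm C (R + 1)) ?_
  · filter_upwards [continuous_proj.continuousAt.preimage_mem_nhds
      (Metric.isOpen_ball.mem_nhds hx)] with x' hx'
    filter_upwards [Measure.ae_ne volume (0 : EuclideanSpace ℝ (Fin 2))] with v hv
    exact norm_bounded_kernel_le hC hR hx' hv
  · filter_upwards [Measure.ae_ne volume (0 : EuclideanSpace ℝ (Fin 2))] with v hv
    exact continuousAt_translated_kernel hf x hv

variable {A : Set (EuclideanSpace ℝ (Fin 2))}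

theorem half_le_norm_sub_lift3 {r : ℝ} {y y₀ : EuclideanSpace ℝ (Fin 2)}
    (hy : y ∉ Metric.ball y₀ r) {x : EuclideanSpace ℝ (Fin 3)}
    (hx : x ∈ Metric.ball (lift3 y₀ 0) (r / 2)) : r / 2 ≤ ‖x - lift3 y 0‖ := by
  rw [Metric.mem_ball, dist_eq_norm] at hx hy
  have h : ‖lift3 y 0 - lift3 y₀ 0‖ ≤ ‖x - lift3 y₀ 0‖ + ‖x - lift3 y 0‖ := by
    calc _ = ‖(x - lift3 y₀ 0) - (x - lift3 y 0)‖ := by congr 1; abel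
      _ ≤ _ := norm_sub_le _ _
  rw [norm_lift3_sub_lift3] at h
  linarith

theorem norm_kernel_le_of_far {r : ℝ} (hr : 0 < r) {y₀ : EuclideanSpace ℝ (Fin 2)}
    (h0 : ∀ y ∈ Metric.ball y₀ r, f y = 0) {x : EuclideanSpace ℝ (Fin 3)}
    (hx : x ∈ Metric.ball (lift3 y₀ 0) (r / 2)) (y : EuclideanSpace ℝ (Fin 2)) :
    ‖f y / ‖x - lift3 y 0‖‖ ≤ ‖f y‖ * (r / 2)⁻¹ := by
  by_cases hy : y ∈ Metric.ball y₀ r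
  · simp [h0 y hy]
  · rw [norm_div, norm_norm, div_eq_mul_inv]
    have := half_le_norm_sub_lift3 hy hx
    gcongr

theorem aestronglyMeasurable_kernel (hf : IntegrableOn f A) (x : EuclideanSpace ℝ (Fin 3)) :
    AEStronglyMeasurable (fun y => f y / ‖x - lift3 y 0‖) (volume.restrict A) := by
  refine (hf.aemeasurable.div (Continuous.measurable ?_).aemeasurable).aestronglyMeasurable
  exact (continuous_const.sub continuous_lift3_zero).norm

theorem integrableOn_kernel_of_far (hf : IntegrableOn f A) {r : ℝ} (hr : 0 < r)
    {y₀ : EuclideanSpace ℝ (Fin 2)} (h0 : ∀ y ∈ Metric.ball y₀ r, f y = 0)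
    {x : EuclideanSpace ℝ (Fin 3)} (hx : x ∈ Metric.ball (lift3 y₀ 0) (r / 2)) :
    IntegrableOn (fun y => f y / ‖x - lift3 y 0‖) A :=
  (hf.norm.mul_const (r / 2)⁻¹).mono' (aestronglyMeasurable_kernel hf x)
    (.of_forall (norm_kernel_le_of_far hr h0 hx))

theorem continuousAt_integral_kernel_of_far (hf : IntegrableOn f A) {r : ℝ} (hr : 0 < r)
    {y₀ : EuclideanSpace ℝ (Fin 2)} (h0 : ∀ y ∈ Metric.ball y₀ r, f y = 0) :
    ContinuousAt (fun x => ∫ y in A, f y / ‖x - lift3 y 0‖) (lift3 y₀ 0) := by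
  refine continuousAt_of_dominated (.of_forall (aestronglyMeasurable_kernel hf)) ?_
    (hf.norm.mul_const (r / 2)⁻¹) (.of_forall fun y => ?_)
  · filter_upwards [Metric.ball_mem_nhds (lift3 y₀ 0) (half_pos hr)] with x hx
    exact .of_forall (norm_kernel_le_of_far hr h0 hx)
  · by_cases hy : y ∈ Metric.ball y₀ r
    · simpa [h0 y hy] using continuousAt_const
    · have := half_le_norm_sub_lift3 hy (Metric.mem_ball_self (half_pos hr))
      exact ContinuousAt.div continuousAt_const (by fun_prop) ((half_pos hr).trans_le this).ne'

/-- The density need not be bounded on `A`. A cutoff `χ` around `y₀` splits it into `χ * f`,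
continuous with compact support in `A`, and `(1 - χ) * f`, merely integrable but zero near `y₀`. -/
theorem continuousAt_singleLayer (hA : IsOpen A) (hf : IntegrableOn f A) (hfc : ContinuousOn f A)
    {y₀ : EuclideanSpace ℝ (Fin 2)} (hy₀ : y₀ ∈ A) :
    ContinuousAt (singleLayer A f) (lift3 y₀ 0) := by
  obtain ⟨R, hR, hRA⟩ := Metric.nhds_basis_closedBall.mem_iff.1 (hA.mem_nhds hy₀)
  set χ : EuclideanSpace ℝ (Fin 2) → ℝ := fun y => min 1 (max 0 (2 - 2 * dist y y₀ / R)) with hχ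
  have hχc : Continuous χ := by fun_prop
  have hχ1 : ∀ y ∈ Metric.ball y₀ (R / 2), χ y = 1 := by
    intro y hy
    have : 2 * dist y y₀ / R ≤ 1 := by
      rw [div_le_one hR]
      linarith [Metric.mem_ball.1 hy]
    exact min_eq_left (le_max_of_le_right (by linarith))
  have hχ0 : ∀ y ∉ Metric.closedBall y₀ R, χ y = 0 := by
    intro y hy
    have : 2 ≤ 2 * dist y y₀ / R := by
      rw [le_div_iff₀ hR]
      rw [Metric.mem_closedBall, not_le] at hy
      linarith
    simp only [hχ]
    rw [max_eq_left (by linarith), min_eq_right zero_le_one]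
  have hχb : ∀ y, ‖χ y‖ ≤ 1 := fun y => by
    rw [Real.norm_of_nonneg (le_min zero_le_one (le_max_left _ _))]
    exact min_le_left _ _
  have hsupp : ∀ y ∉ Metric.closedBall y₀ R, (χ * f) y = 0 := fun y hy => by simp [hχ0 y hy]
  have hts : tsupport (χ * f) ⊆ Metric.closedBall y₀ R :=
    closure_minimal (fun y hy => by_contra fun h => hy (hsupp y h)) Metric.isClosed_closedBall
  have hgc : Continuous (χ * f) :=
    (hχc.continuousOn.mul hfc).continuous_of_tsupport_subset hA (hts.trans hRA)
  obtain ⟨C, hC⟩ := hgc.bounded_above_of_compact_support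
    ((isCompact_closedBall y₀ R).of_isClosed_subset (isClosed_tsupport _) hts)
  have hg2 : IntegrableOn (fun y => (1 - χ y) * f y) A :=
    hf.bdd_mul (c := 2) (by fun_prop) (.of_forall fun y =>
      (norm_sub_le _ _).trans (by rw [norm_one]; linarith [hχb y]))
  have h0 : ∀ y ∈ Metric.ball y₀ (R / 2), (1 - χ y) * f y = 0 := fun y hy => by simp [hχ1 y hy]
  have hx0 : proj (lift3 y₀ 0) ∈ Metric.ball y₀ 1 := by
    have : proj (lift3 y₀ 0) = y₀ := by
      ext i
      fin_cases i <;> simp [proj, lift3]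
    simp [this]
  have h1 := continuousAt_integral_kernel_of_bounded hgc hC hsupp hx0
  have h2 := continuousAt_integral_kernel_of_far hg2 (half_pos hR) h0
  refine ContinuousAt.congr ((h1.add h2).const_mul (1 / (2 * Real.pi))) ?_
  filter_upwards [Metric.ball_mem_nhds (lift3 y₀ 0) (half_pos (half_pos hR)),
    continuous_proj.continuousAt.preimage_mem_nhds (Metric.isOpen_ball.mem_nhds hx0)] with x hx hx'
  rw [singleLayer]
  congr 1
  have hzero : ∀ y ∉ A, (χ * f) y / ‖x - lift3 y 0‖ = 0 := fun y hy => by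
    rw [hsupp y fun h => hy (hRA h), zero_div]
  simp only [Pi.add_apply]
  rw [← setIntegral_eq_integral_of_forall_compl_eq_zero hzero, ← integral_add
    (integrable_kernel_of_bounded hgc hC hsupp hx').integrableOn
    (integrableOn_kernel_of_far hg2 (half_pos hR) h0 hx)]
  congr with y
  simp only [Pi.mul_apply]
  ring

end Potential

/-! ### Absolute integrability of the interaction of two sources -/

section PairBound

/-- A radial majorant of the product of two Newton gradients. -/
noncomputable def majorant (d : ℝ) (v : EuclideanSpace ℝ (Fin 3)) : ℝ :=
  (‖v‖ ^ 2 * (‖v‖ ^ 2 + d ^ 2))⁻¹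

theorem majorant_nonneg (d : ℝ) (v : EuclideanSpace ℝ (Fin 3)) : 0 ≤ majorant d v := by
  unfold majorant
  positivity

theorem integrable_majorant_one : Integrable (majorant 1) := by
  have h : IntegrableOn (fun r : ℝ => r ^ (Module.finrank ℝ (EuclideanSpace ℝ (Fin 3)) - 1) •
      (r ^ 2 * (r ^ 2 + 1 ^ 2))⁻¹) (Ioi 0) := by
    refine integrable_inv_one_add_sq.integrableOn.congr_fun (fun r hr => ?_) measurableSet_Ioi
    have : r ≠ 0 := (mem_Ioi.1 hr).ne'
    simp only [finrank_euclideanSpace_fin, smul_eq_mul]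
    norm_num
    field_simp
    ring
  exact (integrable_fun_norm_addHaar volume (E := EuclideanSpace ℝ (Fin 3))
    (f := fun r : ℝ => (r ^ 2 * (r ^ 2 + 1 ^ 2))⁻¹)).2 h

/-- The majorant is homogeneous of degree `-4` in `(v, d)`. In dimension three its integral then
scales as `1/d`, the same singularity as the kernel of the plane potential. -/
theorem majorant_eq_smul {d : ℝ} (hd : 0 < d) :
    majorant d = fun v => (d ^ 4)⁻¹ * majorant 1 (d⁻¹ • v) := by
  ext v
  rw [majorant, majorant, ← mul_inv, norm_smul, norm_inv, Real.norm_of_nonneg hd.le]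
  congr 1
  field_simp

theorem integrable_majorant {d : ℝ} (hd : 0 < d) : Integrable (majorant d) := by
  rw [majorant_eq_smul hd]
  exact (integrable_majorant_one.comp_smul (inv_ne_zero hd.ne')).const_mul _

theorem integral_majorant {d : ℝ} (hd : 0 < d) :
    ∫ v, majorant d v = (∫ v, majorant 1 v) / d := by
  rw [majorant_eq_smul hd, integral_const_mul, Measure.integral_comp_smul]
  simp only [finrank_euclideanSpace_fin, inv_pow, inv_inv, smul_eq_mul]
  rw [abs_of_pos (by positivity)]
  field_simp

theorem norm_newtonGrad (v : EuclideanSpace ℝ (Fin 3)) : ‖newtonGrad v‖ = (‖v‖ ^ 2)⁻¹ := by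
  rw [newtonGrad, norm_smul, norm_neg, norm_inv, norm_pow, norm_norm]
  by_cases hv : ‖v‖ = 0
  · simp [hv]
  · field_simp

/-- The larger distance satisfies `t ≥ s` and `t ≥ d/2`, so `s² + d² ≤ t² + 4t²`: hence the constant
`5`. -/
theorem inv_sq_mul_inv_sq_le {s t d : ℝ} (hs : 0 < s) (hst : s ≤ t) (hd0 : 0 ≤ d)
    (hd : d ≤ s + t) : (s ^ 2)⁻¹ * (t ^ 2)⁻¹ ≤ 5 * (s ^ 2 * (s ^ 2 + d ^ 2))⁻¹ := by
  have ht : 0 < t := hs.trans_le hst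
  have h : (s ^ 2 + d ^ 2) ≤ 5 * t ^ 2 := by nlinarith
  rw [mul_inv, mul_left_comm]
  refine mul_le_mul_of_nonneg_left ?_ (by positivity)
  rw [← div_eq_mul_inv, inv_eq_one_div, div_le_div_iff₀ (by positivity) (by positivity)]
  linarith

theorem abs_inner_newtonGrad_le (v w : EuclideanSpace ℝ (Fin 3)) :
    ‖inner ℝ (newtonGrad v) (newtonGrad w)‖ ≤
      5 * (majorant ‖v - w‖ v + majorant ‖v - w‖ w) := by
  have h0 := majorant_nonneg ‖v - w‖ v
  have h1 := majorant_nonneg ‖v - w‖ w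
  refine (norm_inner_le_norm _ _).trans ?_
  rw [norm_newtonGrad, norm_newtonGrad]
  rcases eq_or_ne v 0 with rfl | hv
  · simpa using add_nonneg h0 h1
  rcases eq_or_ne w 0 with rfl | hw
  · simpa using add_nonneg h0 h1
  have hd := norm_sub_le v w
  rcases le_total ‖v‖ ‖w‖ with h | h
  · have := inv_sq_mul_inv_sq_le (norm_pos_iff.2 hv) h (norm_nonneg (v - w)) hd
    exact this.trans (by rw [majorant]; linarith)
  · have := inv_sq_mul_inv_sq_le (norm_pos_iff.2 hw) h (norm_nonneg (v - w)) (by linarith)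
    rw [mul_comm]
    exact this.trans (by rw [majorant, majorant] at *; linarith)

/-- The energy density of the interaction of two sources at the plane points `y` and `z`. -/
noncomputable def pairEnergy (y z : EuclideanSpace ℝ (Fin 2)) (x : EuclideanSpace ℝ (Fin 3)) : ℝ :=
  inner ℝ (newtonGrad (x - lift3 y 0)) (newtonGrad (x - lift3 z 0))

theorem measurable_pairEnergy : Measurable fun p : EuclideanSpace ℝ (Fin 3) ×
    EuclideanSpace ℝ (Fin 2) × EuclideanSpace ℝ (Fin 2) => pairEnergy p.2.1 p.2.2 p.1 := by
  have := continuous_lift3_zero.measurable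
  have := measurable_newtonGrad
  unfold pairEnergy
  refine Measurable.inner ?_ ?_ <;> fun_prop

theorem measurable_pairEnergy_right (y z : EuclideanSpace ℝ (Fin 2)) :
    Measurable (pairEnergy y z) := by
  unfold pairEnergy
  exact (measurable_newtonGrad.comp (measurable_id.sub_const (lift3 y 0))).inner
    (measurable_newtonGrad.comp (measurable_id.sub_const (lift3 z 0)))

theorem norm_pairEnergy_le (y z : EuclideanSpace ℝ (Fin 2)) (x : EuclideanSpace ℝ (Fin 3)) :
    ‖pairEnergy y z x‖ ≤
      5 * (majorant ‖y - z‖ (x - lift3 y 0) + majorant ‖y - z‖ (x - lift3 z 0)) := by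
  have h := abs_inner_newtonGrad_le (x - lift3 y 0) (x - lift3 z 0)
  rwa [sub_sub_sub_cancel_left, norm_lift3_sub_lift3, norm_sub_rev] at h

theorem integrable_pairEnergy {y z : EuclideanSpace ℝ (Fin 2)} (hyz : y ≠ z) :
    Integrable (pairEnergy y z) := by
  have hd : 0 < ‖y - z‖ := norm_pos_iff.2 (sub_ne_zero.2 hyz)
  have hm := integrable_majorant hd
  exact (((hm.comp_sub_right (lift3 y 0)).add (hm.comp_sub_right (lift3 z 0))).const_mul 5).mono'
    (measurable_pairEnergy_right y z).aestronglyMeasurable (.of_forall (norm_pairEnergy_le y z))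

theorem integral_norm_pairEnergy_le {y z : EuclideanSpace ℝ (Fin 2)} (hyz : y ≠ z) :
    ∫ x, ‖pairEnergy y z x‖ ≤ 10 * (∫ v, majorant 1 v) / ‖y - z‖ := by
  have hd : 0 < ‖y - z‖ := norm_pos_iff.2 (sub_ne_zero.2 hyz)
  have hm := integrable_majorant hd
  refine (integral_mono (integrable_pairEnergy hyz).norm
    (((hm.comp_sub_right (lift3 y 0)).add (hm.comp_sub_right (lift3 z 0))).const_mul 5)
    (norm_pairEnergy_le y z)).trans_eq ?_
  simp only [Pi.add_apply]
  rw [integral_const_mul, integral_add (hm.comp_sub_right _) (hm.comp_sub_right _),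
    integral_sub_right_eq_self (majorant ‖y - z‖), integral_sub_right_eq_self (majorant ‖y - z‖),
    integral_majorant hd]
  ring

end PairBound

/-! ### The exact interaction energy in a half-space -/

section PairValue

/-- This is the solid angle of a half-space, expressed in the slopes `u` of rays. In polar form the
antiderivative is `-(r² + 1)^(-1/2)`. -/
theorem integral_inv_norm_lift3_cube :
    ∫ u : EuclideanSpace ℝ (Fin 2), (‖lift3 u 1‖ ^ 3)⁻¹ = 2 * Real.pi := by
  have h : ∀ u : EuclideanSpace ℝ (Fin 2), (‖lift3 u 1‖ ^ 3)⁻¹ = (√(‖u‖ ^ 2 + 1) ^ 3)⁻¹ := by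
    intro u
    rw [← Real.sqrt_sq (norm_nonneg (lift3 u 1)), norm_lift3_sq]
    simp
  simp_rw [h]
  rw [integral_fun_norm_addHaar volume (fun r : ℝ => (√(r ^ 2 + 1) ^ 3)⁻¹)]
  have hv : (volume : Measure (EuclideanSpace ℝ (Fin 2))).real (Metric.ball 0 1) = Real.pi := by
    simp [measureReal_def, Real.pi_pos.le]
  have hd : ∀ r : ℝ, HasDerivAt (fun r => -(√(r ^ 2 + 1))⁻¹) (r * (√(r ^ 2 + 1) ^ 3)⁻¹) r := by
    intro r
    have h0 : 0 < r ^ 2 + 1 := by positivity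
    have h1 := ((((hasDerivAt_id r).pow 2).add_const 1).sqrt h0.ne').inv
      (Real.sqrt_pos.2 h0).ne'
    refine h1.neg.congr_deriv ?_
    have := Real.sqrt_pos.2 h0
    simp only [id, Pi.pow_apply]
    norm_num
    field_simp
  have ht : Tendsto (fun r : ℝ => -(√(r ^ 2 + 1))⁻¹) atTop (𝓝 0) := by
    have : Tendsto (fun r : ℝ => (√(r ^ 2 + 1))) atTop atTop :=
      Real.tendsto_sqrt_atTop.comp (tendsto_atTop_add_const_right _ _ (tendsto_pow_atTop two_ne_zero))
    simpa using this.inv_tendsto_atTop.neg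
  have hI := integral_Ioi_of_hasDerivAt_of_nonneg' (a := 0) (fun r _ => hd r)
    (fun r hr => mul_nonneg (mem_Ioi.1 hr).le (by positivity)) ht
  rw [hv]
  simp only [finrank_euclideanSpace_fin, Nat.add_one_sub_one, pow_one, smul_eq_mul, hI]
  norm_num

theorem lift3_zero : lift3 (0 : EuclideanSpace ℝ (Fin 2)) 0 = 0 := by
  ext i
  fin_cases i <;> simp [lift3]

theorem lift3_smul (h : ℝ) (u : EuclideanSpace ℝ (Fin 2)) :
    lift3 (h • u) h = h • lift3 u 1 := by
  ext i
  fin_cases i <;> simp [lift3]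

theorem abs_le_norm_smul_sub (h : ℝ) (u d : EuclideanSpace ℝ (Fin 2)) :
    |h| ≤ ‖h • lift3 u 1 - lift3 d 0‖ := by
  have := PiLp.norm_apply_le (h • lift3 u 1 - lift3 d 0) 2
  simpa [lift3] using this

theorem smul_lift3_sub_ne_zero {d : EuclideanSpace ℝ (Fin 2)} (hd : d ≠ 0)
    (u : EuclideanSpace ℝ (Fin 2)) (h : ℝ) : h • lift3 u 1 - lift3 d 0 ≠ 0 := by
  intro h0
  have h1 := abs_le_norm_smul_sub h u d
  rw [h0, norm_zero, abs_nonpos_iff] at h1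
  rw [h1, zero_smul, zero_sub, neg_eq_zero, ← norm_eq_zero] at h0
  exact hd (norm_le_zero_iff.1 ((norm_le_norm_lift3 d 0).trans h0.le))

theorem hasDerivAt_newton_ray {d : EuclideanSpace ℝ (Fin 2)} (hd : d ≠ 0)
    (u : EuclideanSpace ℝ (Fin 2)) (h : ℝ) :
    HasDerivAt (fun h : ℝ => newton (h • lift3 u 1 - lift3 d 0))
      (inner ℝ (lift3 u 1) (newtonGrad (h • lift3 u 1 - lift3 d 0))) h := by
  have h0 := smul_lift3_sub_ne_zero hd u h
  rw [← fderiv_newton_apply h0]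
  refine HasFDerivAt.comp_hasDerivAt (f := fun h : ℝ => h • lift3 u 1 - lift3 d 0) h
    ((contDiffOn_newton (n := 1)).contDiffAt
    (isOpen_compl_singleton.mem_nhds h0) |>.differentiableAt one_ne_zero).hasFDerivAt ?_
  simpa using ((hasDerivAt_id h).smul_const (lift3 u 1)).sub_const (lift3 d 0)

theorem tendsto_newton_ray (d u : EuclideanSpace ℝ (Fin 2)) :
    Tendsto (fun h : ℝ => newton (h • lift3 u 1 - lift3 d 0)) atTop (𝓝 0) :=
  Tendsto.inv_tendsto_atTop <| tendsto_atTop_mono (fun h => (le_abs_self h).trans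
    (abs_le_norm_smul_sub h u d)) tendsto_id

/-- On a ray from the first source the gradient of its kernel points along the ray and decays as
`h⁻²`. The conical weight leaves a constant times the derivative along the ray of the second
source's kernel. -/
theorem sq_mul_pairEnergy_ray {h : ℝ} (hh : 0 < h) (d u : EuclideanSpace ℝ (Fin 2)) :
    h ^ 2 * pairEnergy 0 d (lift3 (h • u) h) = -(‖lift3 u 1‖ ^ 3)⁻¹ *
      inner ℝ (lift3 u 1) (newtonGrad (h • lift3 u 1 - lift3 d 0)) := by
  rw [pairEnergy, lift3_zero, sub_zero, lift3_smul]
  conv_lhs => rw [newtonGrad]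
  rw [inner_smul_left, inner_smul_left, norm_smul, Real.norm_of_nonneg hh.le, mul_pow]
  simp only [conj_trivial]
  have : ‖lift3 u 1‖ ≠ 0 := by
    have := norm_lift3_sq u 1
    intro h
    rw [h] at this
    nlinarith [sq_nonneg ‖u‖]
  field_simp

theorem measurableSet_upperHalfSpace : MeasurableSet upperHalfSpace :=
  (isOpen_lt continuous_const (by fun_prop)).measurableSet

theorem measurableSet_lowerHalfSpace : MeasurableSet lowerHalfSpace :=
  (isOpen_lt (by fun_prop) continuous_const).measurableSet

/-- By the fundamental theorem of calculus every ray from the origin contributes its angular weight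
times the second kernel at the origin, `1/‖d‖`. The weights add up to the solid angle `2π`. The rays
miss the second source, since `d` lies in the plane. -/
theorem integral_pairEnergy_zero {d : EuclideanSpace ℝ (Fin 2)} (hd : d ≠ 0) :
    ∫ x in upperHalfSpace, pairEnergy 0 d x = 2 * Real.pi / ‖d‖ := by
  have hm : Measurable (upperHalfSpace.indicator (pairEnergy 0 d)) :=
    (measurable_pairEnergy_right 0 d).indicator measurableSet_upperHalfSpace
  have hi : Integrable (upperHalfSpace.indicator (pairEnergy 0 d)) :=
    (integrable_pairEnergy hd.symm).indicator measurableSet_upperHalfSpace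
  have hi' := (integrable_space_cone_iff 0 hm).1 hi
  have hray : ∀ u : EuclideanSpace ℝ (Fin 2), ∀ h : ℝ, h ^ 2 *
      upperHalfSpace.indicator (pairEnergy 0 d) (0 + lift3 (h • u) h) =
      (Ioi 0).indicator (fun h => -(‖lift3 u 1‖ ^ 3)⁻¹ *
        inner ℝ (lift3 u 1) (newtonGrad (h • lift3 u 1 - lift3 d 0))) h := by
    intro u h
    rw [zero_add]
    by_cases hh : 0 < h
    · rw [indicator_of_mem (show h ∈ Ioi 0 from hh), indicator_of_mem, sq_mul_pairEnergy_ray hh]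
      simpa [upperHalfSpace, lift3] using hh
    · rw [indicator_of_notMem (show h ∉ Ioi 0 from hh), indicator_of_notMem, mul_zero]
      simpa [upperHalfSpace, lift3] using hh
  rw [← integral_indicator measurableSet_upperHalfSpace, integral_space_cone 0 hm]
  rw [Measure.volume_eq_prod] at hi' ⊢
  rw [integral_prod _ hi', ← integral_inv_norm_lift3_cube, ← integral_div]
  refine integral_congr_ae ?_
  filter_upwards [hi'.prod_right_ae] with u hu
  simp only [hray] at hu ⊢
  rw [integrable_indicator_iff measurableSet_Ioi] at hu
  rw [integral_indicator measurableSet_Ioi,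
    integral_Ioi_of_hasDerivAt_of_tendsto' (f := fun h : ℝ => -(‖lift3 u 1‖ ^ 3)⁻¹ *
      newton (h • lift3 u 1 - lift3 d 0)) (m := 0)
      (fun h _ => (hasDerivAt_newton_ray hd u h).const_mul _) hu
      (by simpa using (tendsto_newton_ray d u).const_mul (-(‖lift3 u 1‖ ^ 3)⁻¹))]
  have hn : ‖lift3 d 0‖ = ‖d‖ := by
    have := norm_lift3_sub_lift3 d 0
    simpa [lift3_zero] using this
  simp [newton, hn, div_eq_mul_inv]

theorem pairEnergy_translate (y z : EuclideanSpace ℝ (Fin 2)) (x : EuclideanSpace ℝ (Fin 3)) :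
    pairEnergy y z x = pairEnergy 0 (z - y) (x - lift3 y 0) := by
  rw [pairEnergy, pairEnergy]
  congr 2
  · ext i
    fin_cases i <;> simp [lift3]
  · ext i
    fin_cases i <;> simp [lift3]

theorem integral_pairEnergy_upper {y z : EuclideanSpace ℝ (Fin 2)} (hyz : y ≠ z) :
    ∫ x in upperHalfSpace, pairEnergy y z x = 2 * Real.pi / ‖y - z‖ := by
  rw [norm_sub_rev, ← integral_pairEnergy_zero (sub_ne_zero.2 hyz.symm),
    ← integral_indicator measurableSet_upperHalfSpace,
    ← integral_indicator measurableSet_upperHalfSpace,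
    ← integral_sub_right_eq_self (upperHalfSpace.indicator (pairEnergy 0 (z - y)))
      (lift3 y 0)]
  congr with x
  have : x - lift3 y 0 ∈ upperHalfSpace ↔ x ∈ upperHalfSpace := by simp [upperHalfSpace, lift3]
  by_cases hx : x ∈ upperHalfSpace
  · rw [indicator_of_mem hx, indicator_of_mem (this.2 hx), pairEnergy_translate]
  · rw [indicator_of_notMem hx, indicator_of_notMem (fun h => hx (this.1 h))]

theorem newtonGrad_neg (v : EuclideanSpace ℝ (Fin 3)) : newtonGrad (-v) = -newtonGrad v := by
  simp [newtonGrad]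

theorem pairEnergy_neg (y z : EuclideanSpace ℝ (Fin 2)) (x : EuclideanSpace ℝ (Fin 3)) :
    pairEnergy y z (-x) = pairEnergy (-y) (-z) x := by
  have h : ∀ y : EuclideanSpace ℝ (Fin 2), -x - lift3 y 0 = -(x - lift3 (-y) 0) := by
    intro y
    ext i
    fin_cases i <;> simp [lift3] <;> ring
  rw [pairEnergy, pairEnergy, h, h, newtonGrad_neg, newtonGrad_neg, inner_neg_neg]

/-- The point reflection `x ↦ -x` exchanges the half-spaces and preserves the distance between the
reflected sources. -/
theorem integral_pairEnergy_lower {y z : EuclideanSpace ℝ (Fin 2)} (hyz : y ≠ z) :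
    ∫ x in lowerHalfSpace, pairEnergy y z x = 2 * Real.pi / ‖y - z‖ := by
  have hn : ‖y - z‖ = ‖-y - -z‖ := by
    rw [neg_sub_neg, norm_sub_rev]
  rw [hn, ← integral_pairEnergy_upper (neg_injective.ne hyz),
    ← integral_indicator measurableSet_upperHalfSpace,
    ← integral_indicator measurableSet_lowerHalfSpace, ← integral_neg_eq_self]
  congr with x
  have : -x ∈ lowerHalfSpace ↔ x ∈ upperHalfSpace := by simp [upperHalfSpace, lowerHalfSpace]
  by_cases hx : x ∈ upperHalfSpace
  · rw [indicator_of_mem hx, indicator_of_mem (this.2 hx), pairEnergy_neg]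
  · rw [indicator_of_notMem hx, indicator_of_notMem (fun h => hx (this.1 h))]

end PairValue

/-! ### Dirichlet energy as a double integral over the aperture -/

section Energy

variable {A : Set (EuclideanSpace ℝ (Fin 2))} {ρ : EuclideanSpace ℝ (Fin 2) → ℝ}

theorem ae_prod_fst_ne_snd (μ ν : Measure (EuclideanSpace ℝ (Fin 2))) [SFinite μ] [SFinite ν]
    [NullSingletonClass ν] : ∀ᵐ p ∂(μ.prod ν), p.1 ≠ p.2 := by
  have hs : MeasurableSet {p : EuclideanSpace ℝ (Fin 2) × EuclideanSpace ℝ (Fin 2) | p.1 = p.2} :=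
    measurableSet_eq_fun measurable_fst measurable_snd
  rw [ae_iff]
  simp only [ne_eq, not_not]
  rw [Measure.measure_prod_null hs]
  refine .of_forall fun y => ?_
  have : Prod.mk y ⁻¹' {p : EuclideanSpace ℝ (Fin 2) × EuclideanSpace ℝ (Fin 2) | p.1 = p.2} =
      {y} := by
    ext z
    simp [eq_comm]
  simp [this]

/-- Integrating over `x` first, the absolute interaction is at most a constant times `1/‖y - z‖` off
the null diagonal, so `hpair` suffices. -/
theorem integrable_interaction (hρm : Measurable ρ)
    (hpair : Integrable (fun p => ρ p.1 * ρ p.2 / ‖p.1 - p.2‖)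
      ((volume.restrict A).prod (volume.restrict A))) (U : Set (EuclideanSpace ℝ (Fin 3))) :
    Integrable (fun q : EuclideanSpace ℝ (Fin 3) × EuclideanSpace ℝ (Fin 2) ×
      EuclideanSpace ℝ (Fin 2) => ρ q.2.1 * ρ q.2.2 * pairEnergy q.2.1 q.2.2 q.1)
      ((volume.restrict U).prod ((volume.restrict A).prod (volume.restrict A))) := by
  have hm : AEStronglyMeasurable (fun q : EuclideanSpace ℝ (Fin 3) × EuclideanSpace ℝ (Fin 2) ×
      EuclideanSpace ℝ (Fin 2) => ρ q.2.1 * ρ q.2.2 * pairEnergy q.2.1 q.2.2 q.1)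
      ((volume.restrict U).prod ((volume.restrict A).prod (volume.restrict A))) :=
    (Measurable.mul (by fun_prop) measurable_pairEnergy).aestronglyMeasurable
  have hne := ae_prod_fst_ne_snd (volume.restrict A) (volume.restrict A)
  refine (integrable_prod_iff' hm).2 ⟨?_, ?_⟩
  · filter_upwards [hne] with p hp
    exact (integrable_pairEnergy hp).integrableOn.const_mul (ρ p.1 * ρ p.2)
  · refine (hpair.norm.mul_const (10 * ∫ v, majorant 1 v)).mono'
      hm.norm.prod_swap.integral_prod_right' ?_
    filter_upwards [hne] with p hp
    have hle : ∫ x in U, ‖pairEnergy p.1 p.2 x‖ ≤ 10 * (∫ v, majorant 1 v) / ‖p.1 - p.2‖ :=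
      (setIntegral_le_integral (integrable_pairEnergy hp).norm
        (.of_forall fun x => norm_nonneg _)).trans (integral_norm_pairEnergy_le hp)
    rw [Real.norm_of_nonneg (integral_nonneg fun x => norm_nonneg _)]
    simp only [norm_mul (ρ p.1 * ρ p.2)]
    rw [integral_const_mul, norm_div, norm_norm]
    calc _ ≤ ‖ρ p.1 * ρ p.2‖ * (10 * (∫ v, majorant 1 v) / ‖p.1 - p.2‖) := by gcongr
      _ = _ := by ring

theorem integral_interaction_eq_norm_sq (hA : Bornology.IsBounded A) (hAm : MeasurableSet A)
    (hρ : IntegrableOn ρ A) {x : EuclideanSpace ℝ (Fin 3)} (hx : x ∈ offLayer A)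
    (hi : Integrable (fun p : EuclideanSpace ℝ (Fin 2) × EuclideanSpace ℝ (Fin 2) =>
      ρ p.1 * ρ p.2 * pairEnergy p.1 p.2 x) ((volume.restrict A).prod (volume.restrict A))) :
    ∫ p, ρ p.1 * ρ p.2 * pairEnergy p.1 p.2 x ∂((volume.restrict A).prod (volume.restrict A)) =
      ‖layer A ρ newtonGrad x‖ ^ 2 := by
  have hl := integrable_layer hA hAm hρ continuousOn_newtonGrad hx
  have hp : ∀ y z, ρ y * ρ z * pairEnergy y z x = inner ℝ (ρ y • newtonGrad (x - lift3 y 0))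
      (ρ z • newtonGrad (x - lift3 z 0)) := by
    intro y z
    rw [inner_smul_left, inner_smul_right, pairEnergy]
    simp only [conj_trivial]
    ring
  rw [integral_prod _ hi, ← real_inner_self_eq_norm_sq]
  simp only [hp]
  calc _ = ∫ y in A, inner ℝ (layer A ρ newtonGrad x) (ρ y • newtonGrad (x - lift3 y 0)) := by
        congr with y
        rw [integral_inner hl, real_inner_comm]
        rfl
    _ = _ := integral_inner hl _

theorem hasDirichletEnergy_singleLayer (hA : Bornology.IsBounded A) (hAm : MeasurableSet A)
    (hρm : Measurable ρ) (hρ : IntegrableOn ρ A)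
    (hpair : Integrable (fun p => ρ p.1 * ρ p.2 / ‖p.1 - p.2‖)
      ((volume.restrict A).prod (volume.restrict A)))
    {U : Set (EuclideanSpace ℝ (Fin 3))} (hU : U = upperHalfSpace ∨ U = lowerHalfSpace) :
    HasDirichletEnergy (singleLayer A ρ) U (1 / (2 * Real.pi) *
      ∫ p, ρ p.1 * ρ p.2 / ‖p.1 - p.2‖ ∂((volume.restrict A).prod (volume.restrict A))) := by
  have hUm : MeasurableSet U := by
    rcases hU with rfl | rfl
    exacts [measurableSet_upperHalfSpace, measurableSet_lowerHalfSpace]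
  have hU0 : ∀ x ∈ U, x 2 ≠ 0 := by
    rcases hU with rfl | rfl
    exacts [fun x hx => ne_of_gt hx, fun x hx => ne_of_lt hx]
  have hJ : ∀ y z, y ≠ z → ∫ x in U, pairEnergy y z x = 2 * Real.pi / ‖y - z‖ := by
    rcases hU with rfl | rfl
    exacts [fun y z => integral_pairEnergy_upper, fun y z => integral_pairEnergy_lower]
  have hi := integrable_interaction hρm hpair U
  -- Only almost everywhere: integrability over pairs of sources at a given `x` is obtained from
  -- Fubini.
  have hae : (fun x => (1 / (2 * Real.pi)) ^ 2 * ∫ p, ρ p.1 * ρ p.2 * pairEnergy p.1 p.2 x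
      ∂((volume.restrict A).prod (volume.restrict A))) =ᵐ[volume.restrict U]
      fun x => ‖∇ (singleLayer A ρ) x‖ ^ 2 := by
    filter_upwards [hi.prod_right_ae, ae_restrict_mem hUm] with x hx hxU
    have hxV : x ∈ offLayer A := mem_offLayer (hU0 x hxU)
    rw [gradient_singleLayer hA hAm hρ hxV, norm_smul, mul_pow,
      integral_interaction_eq_norm_sq hA hAm hρ hxV hx, Real.norm_eq_abs, sq_abs]
  refine ⟨(hi.integral_prod_left.const_mul _).congr hae, ?_⟩
  rw [← integral_congr_ae hae, integral_const_mul, ← integral_prod _ hi,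
    integral_prod_symm _ hi, ← integral_const_mul, ← integral_const_mul]
  refine integral_congr_ae ?_
  filter_upwards [ae_prod_fst_ne_snd (volume.restrict A) (volume.restrict A)] with p hp
  rw [integral_const_mul, hJ _ _ hp]
  have := Real.pi_pos
  field_simp

/-- An integrable density whose absolute value has a bounded potential on `A` has finite absolute
mutual energy. -/
theorem integrable_pair_of_bounded_potential (hAm : MeasurableSet A) (hρm : Measurable ρ)
    (hρ : IntegrableOn ρ A) {C : ℝ}
    (hi : ∀ y ∈ A, IntegrableOn (fun z => ρ z / ‖y - z‖) A)
    (hC : ∀ y ∈ A, ∫ z in A, ‖ρ z / ‖y - z‖‖ ≤ C) :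
    Integrable (fun p => ρ p.1 * ρ p.2 / ‖p.1 - p.2‖)
      ((volume.restrict A).prod (volume.restrict A)) := by
  have hm : AEStronglyMeasurable (fun p : EuclideanSpace ℝ (Fin 2) × EuclideanSpace ℝ (Fin 2) =>
      ρ p.1 * ρ p.2 / ‖p.1 - p.2‖) ((volume.restrict A).prod (volume.restrict A)) :=
    (Measurable.div (by fun_prop) (by fun_prop)).aestronglyMeasurable
  refine (integrable_prod_iff hm).2 ⟨?_, ?_⟩
  · filter_upwards [ae_restrict_mem hAm] with y hy
    simpa only [mul_div_assoc] using (hi y hy).const_mul (ρ y)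
  · refine (hρ.norm.mul_const C).mono' hm.norm.integral_prod_right' ?_
    filter_upwards [ae_restrict_mem hAm] with y hy
    rw [Real.norm_of_nonneg (integral_nonneg fun x => norm_nonneg _)]
    simp only [mul_div_assoc, norm_mul (ρ y)]
    rw [integral_const_mul]
    exact mul_le_mul_of_nonneg_left (hC y hy) (norm_nonneg _)

theorem hasDirichletEnergy_of_potential (hA : Bornology.IsBounded A) (hAm : MeasurableSet A)
    (hρm : Measurable ρ) (hρ : IntegrableOn ρ A) {C : ℝ}
    (hi : ∀ y ∈ A, IntegrableOn (fun z => ρ z / ‖y - z‖) A)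
    (hC : ∀ y ∈ A, ∫ z in A, ‖ρ z / ‖y - z‖‖ ≤ C) {g : EuclideanSpace ℝ (Fin 2) → ℝ}
    (hg : ∀ y ∈ A, 1 / (2 * Real.pi) * ∫ z in A, ρ z / ‖y - z‖ = g y)
    {U : Set (EuclideanSpace ℝ (Fin 3))} (hU : U = upperHalfSpace ∨ U = lowerHalfSpace) :
    HasDirichletEnergy (singleLayer A ρ) U (∫ y in A, ρ y * g y) := by
  have hpair := integrable_pair_of_bounded_potential hAm hρm hρ hi hC
  convert hasDirichletEnergy_singleLayer hA hAm hρm hρ hpair hU using 1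
  rw [integral_prod _ hpair, ← integral_const_mul]
  refine setIntegral_congr_fun hAm fun y hy => ?_
  beta_reduce
  rw [← hg y hy]
  simp only [mul_div_assoc, integral_const_mul]
  ring

end Energy

/-! ### Moments of the profile and conclusions for the ellipse -/

section Ellipse

variable {a b : ℝ}

theorem isOpen_ellipticDisk : IsOpen (ellipticDisk a b) :=
  isOpen_lt (by fun_prop) continuous_const

theorem isBounded_ellipticDisk (hb : 0 < b) (hab : b ≤ a) :
    Bornology.IsBounded (ellipticDisk a b) := by
  have ha : 0 < a := hb.trans_le hab
  refine Metric.isBounded_closedBall (x := (0 : EuclideanSpace ℝ (Fin 2))) (r := a) |>.subset ?_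
  intro y hy
  rw [mem_closedBall_zero_iff]
  refine le_of_sq_le_sq ?_ ha.le
  have h : y 0 ^ 2 / a ^ 2 + y 1 ^ 2 / b ^ 2 < 1 := hy
  have h1 : y 1 ^ 2 / a ^ 2 ≤ y 1 ^ 2 / b ^ 2 := by gcongr
  have h2 : (y 0 ^ 2 + y 1 ^ 2) / a ^ 2 < 1 := by
    rw [add_div]
    linarith
  rw [div_lt_one (by positivity)] at h2
  rw [EuclideanSpace.norm_sq_eq, Fin.sum_univ_two]
  simpa using h2.le

theorem profile_slice (s t : ℝ) : profile a b !₂[s, t] =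
    (√((1 - s ^ 2 / a ^ 2) - 1 / b ^ 2 * (t - 0) ^ 2))⁻¹ := by
  simp only [profile, Matrix.cons_val_zero, Matrix.cons_val_one]
  congr 2
  ring

theorem one_sub_sq_div_pos (ha : 0 < a) {s : ℝ} (hs : s ∈ Ioo (-a) a) : 0 < 1 - s ^ 2 / a ^ 2 := by
  have : s ^ 2 / a ^ 2 < 1 := by
    rw [div_lt_one (by positivity)]
    exact sq_lt_sq' hs.1 hs.2
  linarith

theorem profile_slice_eq_zero (ha : 0 < a) {s : ℝ} (hs : s ∉ Ioo (-a) a) (t : ℝ) :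
    profile a b !₂[s, t] = 0 := by
  have h1 : 1 ≤ s ^ 2 / a ^ 2 := by
    rw [one_le_div (by positivity)]
    refine sq_le_sq.2 ?_
    rw [abs_of_pos ha]
    by_contra! h
    exact hs (abs_lt.1 h)
  refine profile_eq_zero fun h => ?_
  have h2 : s ^ 2 / a ^ 2 + t ^ 2 / b ^ 2 < 1 := by simpa [ellipticDisk] using h
  have : 0 ≤ t ^ 2 / b ^ 2 := by positivity
  linarith

theorem integrable_profile_slice (ha : 0 < a) (hb : 0 < b) (s : ℝ) :
    Integrable fun t : ℝ => profile a b !₂[s, t] := by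
  by_cases hs : s ∈ Ioo (-a) a
  · simp_rw [profile_slice]
    exact integrable_inv_sqrt_sub_mul_sq (one_sub_sq_div_pos ha hs) (by positivity) 0
  · simp [profile_slice_eq_zero ha hs]

/-- All vertical slices carry the same mass, again because the chord integral ignores `M`. So the
moments in `y 0` are those of a constant density on `(-a, a)`. -/
theorem integral_profile_slice (ha : 0 < a) (hb : 0 < b) (s : ℝ) :
    ∫ t : ℝ, profile a b !₂[s, t] = (Ioo (-a) a).indicator (fun _ => Real.pi * b) s := by
  by_cases hs : s ∈ Ioo (-a) a
  · simp_rw [profile_slice]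
    rw [integral_inv_sqrt_sub_mul_sq (one_sub_sq_div_pos ha hs) (by positivity) 0,
      indicator_of_mem hs, Real.sqrt_div zero_le_one, Real.sqrt_one, Real.sqrt_sq hb.le]
    field_simp
  · simp [profile_slice_eq_zero ha hs, indicator_of_notMem hs]

theorem integrable_profile (ha : 0 < a) (hb : 0 < b) : Integrable (profile a b) := by
  rw [← measurePreserving_planeEquiv.integrable_comp_emb planeEquiv.measurableEmbedding]
  have h : profile a b ∘ planeEquiv = fun p : ℝ × ℝ => profile a b !₂[p.1, p.2] := rfl
  rw [h, Measure.volume_eq_prod, integrable_prod_iff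
    (h ▸ (measurable_profile.comp planeEquiv.measurable).aestronglyMeasurable)]
  refine ⟨.of_forall fun s => integrable_profile_slice ha hb s, ?_⟩
  have h1 : ∀ s t : ℝ, ‖profile a b !₂[s, t]‖ = profile a b !₂[s, t] := fun s t =>
    Real.norm_of_nonneg (profile_nonneg _)
  simp only [h1, integral_profile_slice ha hb]
  exact (integrable_indicator_iff measurableSet_Ioo).2 (integrableOn_const (by simp))

theorem integral_pow_mul_profile (ha : 0 < a) (hb : 0 < b) (n : ℕ)
    (hi : Integrable fun y : EuclideanSpace ℝ (Fin 2) => y 0 ^ n * profile a b y) :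
    ∫ y : EuclideanSpace ℝ (Fin 2), y 0 ^ n * profile a b y =
      Real.pi * b * ((a ^ (n + 1) - (-a) ^ (n + 1)) / (n + 1)) := by
  rw [← measurePreserving_planeEquiv.integrable_comp_emb planeEquiv.measurableEmbedding] at hi
  rw [← measurePreserving_planeEquiv.integral_comp planeEquiv.measurableEmbedding]
  have h : ∀ p : ℝ × ℝ, (planeEquiv p) 0 ^ n * profile a b (planeEquiv p) =
      p.1 ^ n * profile a b !₂[p.1, p.2] := fun p => rfl
  simp only [Function.comp_def, h] at hi ⊢
  rw [Measure.volume_eq_prod] at hi ⊢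
  rw [integral_prod _ hi]
  simp only [integral_const_mul, integral_profile_slice ha hb]
  have h2 : ∀ s : ℝ, s ^ n * (Ioo (-a) a).indicator (fun _ => Real.pi * b) s =
      (Ioo (-a) a).indicator (fun s => Real.pi * b * s ^ n) s := by
    intro s
    by_cases hs : s ∈ Ioo (-a) a
    · rw [indicator_of_mem hs, indicator_of_mem hs, mul_comm]
    · rw [indicator_of_notMem hs, indicator_of_notMem hs, mul_zero]
  simp only [h2]
  rw [integral_indicator measurableSet_Ioo, integral_const_mul, ← integral_Ioc_eq_integral_Ioo,
    ← intervalIntegral.integral_of_le (by linarith), integral_pow]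

theorem ellipticK_zero : ellipticK 0 = Real.pi / 2 := by simp [ellipticK]

theorem ellipticD_zero : ellipticD 0 = Real.pi / 4 := by
  simp [ellipticD, integral_sin_sq]
  ring

theorem continuousOn_profile : ContinuousOn (profile a b) (ellipticDisk a b) := by
  refine ContinuousOn.inv₀ (by fun_prop) fun y hy => ?_
  have h : y 0 ^ 2 / a ^ 2 + y 1 ^ 2 / b ^ 2 < 1 := hy
  exact (Real.sqrt_pos.2 (by linarith)).ne'

theorem setIntegral_ellipticDisk {f : EuclideanSpace ℝ (Fin 2) → ℝ}
    (hf : ∀ y ∉ ellipticDisk a b, f y = 0) : ∫ y in ellipticDisk a b, f y = ∫ y, f y :=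
  setIntegral_eq_integral_of_forall_compl_eq_zero hf

theorem measurable_rhoW : Measurable (rhoW a b) := by
  rw [rhoW_eq]
  fun_prop

theorem measurable_rhoT : Measurable (rhoT a b) := by
  rw [rhoT_eq]
  fun_prop

theorem integrable_coord_mul_profile (ha : 0 < a) (hb : 0 < b) :
    Integrable fun y : EuclideanSpace ℝ (Fin 2) => y 0 * profile a b y :=
  ((integrable_profile ha hb).const_mul a).mono' (by fun_prop)
    (.of_forall (abs_coord_mul_profile_le ha))

theorem integrable_rhoW (ha : 0 < a) (hb : 0 < b) : Integrable (rhoW a b) := by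
  rw [rhoW_eq]
  exact (integrable_profile ha hb).const_mul _

theorem integrable_rhoT (ha : 0 < a) (hb : 0 < b) : Integrable (rhoT a b) := by
  rw [rhoT_eq]
  exact (integrable_coord_mul_profile ha hb).const_mul _

theorem integrable_rhoW_kernel (hb : 0 < b) (hab : b ≤ a) {x : EuclideanSpace ℝ (Fin 2)}
    (hx : x ∈ ellipticDisk a b) : Integrable fun y => rhoW a b y / ‖x - y‖ := by
  simp only [rhoW_eq, mul_div_assoc]
  exact (integrable_profile_kernel hb hab hx).const_mul _

theorem integrable_rhoT_kernel (hb : 0 < b) (hab : b ≤ a) {x : EuclideanSpace ℝ (Fin 2)}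
    (hx : x ∈ ellipticDisk a b) : Integrable fun y => rhoT a b y / ‖x - y‖ := by
  simp only [rhoT_eq, mul_div_assoc]
  simpa only [mul_div_assoc] using (integrable_coord_mul_profile_kernel hb hab hx).const_mul _

theorem potential_rhoW (hb : 0 < b) (hab : b ≤ a) {x : EuclideanSpace ℝ (Fin 2)}
    (hx : x ∈ ellipticDisk a b) :
    1 / (2 * Real.pi) * ∫ y in ellipticDisk a b, rhoW a b y / ‖x - y‖ = 1 := by
  rw [setIntegral_ellipticDisk fun y hy => by simp [rhoW_eq, profile_eq_zero hy]]
  simp only [rhoW_eq, mul_div_assoc]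
  rw [integral_const_mul, integral_profile_kernel hb hab hx]
  have := ellipticK_pos hb hab
  have := Real.pi_pos
  field_simp

theorem potential_rhoT (hb : 0 < b) (hab : b ≤ a) {x : EuclideanSpace ℝ (Fin 2)}
    (hx : x ∈ ellipticDisk a b) :
    1 / (2 * Real.pi) * ∫ y in ellipticDisk a b, rhoT a b y / ‖x - y‖ = x 0 := by
  rw [setIntegral_ellipticDisk fun y hy => by simp [rhoT_eq, profile_eq_zero hy]]
  have h := integral_coord_mul_profile_kernel hb hab hx
  simp only [rhoT_eq, mul_div_assoc] at h ⊢
  rw [integral_const_mul, h]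
  have := ellipticD_pos hb hab
  have := Real.pi_pos
  field_simp

theorem solvesApertureProblem_singleLayer {A : Set (EuclideanSpace ℝ (Fin 2))}
    {ρ g : EuclideanSpace ℝ (Fin 2) → ℝ} (hA : Bornology.IsBounded A) (hAo : IsOpen A)
    (hρ : IntegrableOn ρ A) (hρc : ContinuousOn ρ A)
    (hg : ∀ y ∈ A, 1 / (2 * Real.pi) * ∫ z in A, ρ z / ‖y - z‖ = g y) :
    SolvesApertureProblem A g (singleLayer A ρ) where
  harmonic x hx := harmonicOnNhd_singleLayer hA hAo.measurableSet hρ x (mem_offLayer hx)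
  neumann _ hy := hasDerivAt_singleLayer_lift3 hA hAo.measurableSet hρ hy
  continuousAt _ hy := continuousAt_singleLayer hAo hρ hρc hy
  dirichlet y hy := by
    rw [← hg y hy]
    simp only [singleLayer, norm_lift3_sub_lift3]

theorem integral_norm_rhoW_kernel (hb : 0 < b) (hab : b ≤ a) {x : EuclideanSpace ℝ (Fin 2)}
    (hx : x ∈ ellipticDisk a b) :
    ∫ y in ellipticDisk a b, ‖rhoW a b y / ‖x - y‖‖ = 2 * Real.pi := by
  have hK := ellipticK_pos hb hab
  have h : ∀ y, ‖rhoW a b y / ‖x - y‖‖ = rhoW a b y / ‖x - y‖ := fun y => by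
    have := profile_nonneg (a := a) (b := b) y
    refine Real.norm_of_nonneg ?_
    rw [rhoW_eq]
    positivity
  simp only [h]
  have := potential_rhoW hb hab hx
  have := Real.pi_pos
  field_simp at *
  linarith

/-- Since `|y 0| ≤ a` on the ellipse, the boundedness of the potential of `rhoW` carries over to
that of `|rhoT|`, as the energy formula requires. -/
theorem abs_rhoT_le (hb : 0 < b) (hab : b ≤ a) (y : EuclideanSpace ℝ (Fin 2)) :
    ‖rhoT a b y‖ ≤ a * ellipticK (eccentricity a b) / ellipticD (eccentricity a b) *
      rhoW a b y := by
  have hK := ellipticK_pos hb hab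
  have hD := ellipticD_pos hb hab
  rw [rhoT_eq, rhoW_eq, norm_mul, Real.norm_of_nonneg (by positivity)]
  calc _ ≤ (b * ellipticD (eccentricity a b))⁻¹ * (a * profile a b y) := by
        gcongr
        exact abs_coord_mul_profile_le (hb.trans_le hab) y
    _ = _ := by field_simp

theorem integral_norm_rhoT_kernel_le (hb : 0 < b) (hab : b ≤ a) {x : EuclideanSpace ℝ (Fin 2)}
    (hx : x ∈ ellipticDisk a b) :
    ∫ y in ellipticDisk a b, ‖rhoT a b y / ‖x - y‖‖ ≤
      a * ellipticK (eccentricity a b) / ellipticD (eccentricity a b) * (2 * Real.pi) := by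
  have hK := ellipticK_pos hb hab
  have hD := ellipticD_pos hb hab
  have ha := hb.trans_le hab
  rw [← integral_norm_rhoW_kernel hb hab hx, ← integral_const_mul]
  refine integral_mono (integrable_rhoT_kernel hb hab hx).norm.integrableOn
    ((integrable_rhoW_kernel hb hab hx).norm.const_mul _).integrableOn fun y => ?_
  simp only [norm_div, norm_norm, ← mul_div_assoc]
  refine div_le_div_of_nonneg_right ((abs_rhoT_le hb hab y).trans ?_) (norm_nonneg _)
  exact mul_le_mul_of_nonneg_left (le_abs_self _) (by positivity)

theorem hasDirichletEnergy_potW (hb : 0 < b) (hab : b ≤ a)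
    {U : Set (EuclideanSpace ℝ (Fin 3))} (hU : U = upperHalfSpace ∨ U = lowerHalfSpace) :
    HasDirichletEnergy (potW a b) U
      (4 * a * (ellipticK 0 / ellipticK (eccentricity a b))) := by
  have ha := hb.trans_le hab
  have hK := ellipticK_pos hb hab
  convert hasDirichletEnergy_of_potential (isBounded_ellipticDisk hb hab)
    isOpen_ellipticDisk.measurableSet measurable_rhoW (integrable_rhoW ha hb).integrableOn
    (fun y hy => (integrable_rhoW_kernel hb hab hy).integrableOn)
    (fun y hy => (integral_norm_rhoW_kernel hb hab hy).le)
    (fun y hy => potential_rhoW hb hab hy) hU using 1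
  on_goal 1 => rfl
  rw [setIntegral_ellipticDisk fun y hy => by simp [rhoW_eq, profile_eq_zero hy]]
  -- The datum is `1`, so the energy is the total mass of the density; the profile has mass `2πab`.
  have h := integral_pow_mul_profile ha hb 0 (by simpa using integrable_profile ha hb)
  simp only [pow_zero, one_mul, zero_add, pow_one, Nat.cast_zero] at h
  simp only [mul_one, rhoW_eq]
  rw [integral_const_mul, h, ellipticK_zero]
  field_simp
  ring

theorem hasDirichletEnergy_potT (hb : 0 < b) (hab : b ≤ a)
    {U : Set (EuclideanSpace ℝ (Fin 3))} (hU : U = upperHalfSpace ∨ U = lowerHalfSpace) :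
    HasDirichletEnergy (potT a b) U
      (8 / 3 * a ^ 3 * (ellipticD 0 / ellipticD (eccentricity a b))) := by
  have ha := hb.trans_le hab
  have hD := ellipticD_pos hb hab
  convert hasDirichletEnergy_of_potential (isBounded_ellipticDisk hb hab)
    isOpen_ellipticDisk.measurableSet measurable_rhoT (integrable_rhoT ha hb).integrableOn
    (fun y hy => (integrable_rhoT_kernel hb hab hy).integrableOn)
    (fun y hy => integral_norm_rhoT_kernel_le hb hab hy)
    (fun y hy => potential_rhoT hb hab hy) hU using 1
  on_goal 1 => rfl
  rw [setIntegral_ellipticDisk fun y hy => by simp [rhoT_eq, profile_eq_zero hy]]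
  have hi : Integrable fun y : EuclideanSpace ℝ (Fin 2) => y 0 ^ 2 * profile a b y := by
    refine ((integrable_profile ha hb).const_mul (a ^ 2)).mono' (by fun_prop)
      (.of_forall fun y => ?_)
    rw [Real.norm_of_nonneg (mul_nonneg (sq_nonneg _) (profile_nonneg y))]
    by_cases hy : y ∈ ellipticDisk a b
    · exact mul_le_mul_of_nonneg_right (sq_le_sq.2 (by
        rw [abs_of_pos ha]; exact abs_coord_le ha hy)) (profile_nonneg y)
    · simp [profile_eq_zero hy]
  -- The datum `y 0` and the factor `y 0` in the density give the second moment of the profile,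
  -- `2πa³b/3`.
  have h := integral_pow_mul_profile ha hb 2 hi
  have h2 : ∀ y : EuclideanSpace ℝ (Fin 2), rhoT a b y * y 0 =
      (b * ellipticD (eccentricity a b))⁻¹ * (y 0 ^ 2 * profile a b y) := fun y => by
    rw [rhoT_eq]
    ring
  simp only [h2]
  rw [integral_const_mul, h, ellipticD_zero]
  push_cast
  field_simp
  ring

theorem continuousOn_rhoW : ContinuousOn (rhoW a b) (ellipticDisk a b) := by
  rw [rhoW_eq]
  exact continuousOn_const.mul continuousOn_profile

theorem continuousOn_rhoT : ContinuousOn (rhoT a b) (ellipticDisk a b) := by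
  rw [rhoT_eq]
  exact continuousOn_const.mul (ContinuousOn.mul (by fun_prop) continuousOn_profile)

end Ellipse

end EllipticAperture

theorem mainTheorem2 (a b : ℝ) (hb : 0 < b) (hab : b ≤ a) :
    -- the single-layer integral of `ρ_w` converges and is equal to `1` on the elliptic disk
    (∀ x ∈ EllipticAperture.ellipticDisk a b,
      MeasureTheory.IntegrableOn (fun y => EllipticAperture.rhoW a b y / ‖x - y‖)
        (EllipticAperture.ellipticDisk a b) ∧
      1 / (2 * Real.pi) * ∫ y in EllipticAperture.ellipticDisk a b,
        EllipticAperture.rhoW a b y / ‖x - y‖ = 1) ∧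
    -- the single-layer integral of `ρ_t` converges and is equal to `x₁` on the elliptic disk
    (∀ x ∈ EllipticAperture.ellipticDisk a b,
      MeasureTheory.IntegrableOn (fun y => EllipticAperture.rhoT a b y / ‖x - y‖)
        (EllipticAperture.ellipticDisk a b) ∧
      1 / (2 * Real.pi) * ∫ y in EllipticAperture.ellipticDisk a b,
        EllipticAperture.rhoT a b y / ‖x - y‖ = x 0) ∧
    -- the potentials in space solve the aperture problem with Dirichlet data `1` and `x₁`
    EllipticAperture.SolvesApertureProblem (EllipticAperture.ellipticDisk a b)
      (fun _ => 1) (EllipticAperture.potW a b) ∧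
    EllipticAperture.SolvesApertureProblem (EllipticAperture.ellipticDisk a b)
      (fun y => y 0) (EllipticAperture.potT a b) ∧
    -- the energy of each potential in each of the two half-spaces
    (∀ U, U = EllipticAperture.upperHalfSpace ∨ U = EllipticAperture.lowerHalfSpace →
      EllipticAperture.HasDirichletEnergy (EllipticAperture.potW a b) U
        (4 * a * (EllipticAperture.ellipticK 0 /
          EllipticAperture.ellipticK (EllipticAperture.eccentricity a b))) ∧
      EllipticAperture.HasDirichletEnergy (EllipticAperture.potT a b) U
        (8 / 3 * a ^ 3 * (EllipticAperture.ellipticD 0 /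
          EllipticAperture.ellipticD (EllipticAperture.eccentricity a b)))) := by
  have ha : 0 < a := hb.trans_le hab
  exact ⟨fun x hx => ⟨(EllipticAperture.integrable_rhoW_kernel hb hab hx).integrableOn,
      EllipticAperture.potential_rhoW hb hab hx⟩,
    fun x hx => ⟨(EllipticAperture.integrable_rhoT_kernel hb hab hx).integrableOn,
      EllipticAperture.potential_rhoT hb hab hx⟩,
    EllipticAperture.solvesApertureProblem_singleLayer
      (EllipticAperture.isBounded_ellipticDisk hb hab) EllipticAperture.isOpen_ellipticDisk
      (EllipticAperture.integrable_rhoW ha hb).integrableOn EllipticAperture.continuousOn_rhoW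
      fun y hy => EllipticAperture.potential_rhoW hb hab hy,
    EllipticAperture.solvesApertureProblem_singleLayer
      (EllipticAperture.isBounded_ellipticDisk hb hab) EllipticAperture.isOpen_ellipticDisk
      (EllipticAperture.integrable_rhoT ha hb).integrableOn EllipticAperture.continuousOn_rhoT
      fun y hy => EllipticAperture.potential_rhoT hb hab hy,
    fun U hU => ⟨EllipticAperture.hasDirichletEnergy_potW hb hab hU,
      EllipticAperture.hasDirichletEnergy_potT hb hab hU⟩⟩
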